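/- Let $M$ be a smooth, connected, compact, boundaryless manifold, equipped with a distance $d$ inducing its topology and with a (continuous) Riemannian metric, and let $1\le r\le\infty$. Let $f\in\mathrm{Diff}^r(M)$ and let $g\in Z(f)=\{g\in\mathrm{Diff}^r(M) : fg=gf\}$. Suppose that $\Lambda\subset M$ is a chain recurrent class of $f$, that $f|_\Lambda$ is mixing, that $\Lambda$ is a hyperbolic set for $f$, and that $\Lambda$ is a hyperbolic set for $g$. Then $\Lambda$ is a locally maximal hyperbolic set for $g$. Here the following terms are used. - For $\epsilon>0$, an $\epsilon$-chain for $f$ from $x$ to $y$ is a finite sequence $x=x_0,\dots,x_n=y$, $n\ge 1$, with $d(f(x_{j-1}),x_j)<\epsilon$ for $1\le j\le n$. The chain recurrent set $\mathcal R(f)$ is the set of all $x$ such that for every $\epsilon>0$ there is an $\epsilon$-chain from $x$ to $x$. The chain recurrent class of $x\in\mathcal R(f)$ is the set of all $y\in\mathcal R(f)$ such that for every $\epsilon>0$ there are $\epsilon$-chains from $x$ to $y$ and from $y$ to $x$. - $f|_\Lambda$ is mixing if for all nonempty relatively open subsets $U,V$ of $\Lambda$ there is $N\in\mathbb N$ such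 that $f^n(U)\cap V\ne\emptyset$ for all $n\ge N$. - A compact set $\Lambda$ is hyperbolic for a diffeomorphism $h$ if $h(\Lambda)=\Lambda$ and there are a splitting $T_xM=E^u_x\oplus E^s_x$ for $x\in\Lambda$ with $Dh_x(E^u_x)=E^u_{h(x)}$ and $Dh_x(E^s_x)=E^s_{h(x)}$, and constants $C>0$ and $0<\lambda<1$, such that for all $x\in\Lambda$ and $n\in\mathbb N$ one has $\|Dh^n_xv\|\le C\lambda^n\|v\|$ for $v\in E^s_x$ and $\|Dh^{-n}_xv\|\le C\lambda^n\|v\|$ for $v\in E^u_x$. - A hyperbolic set $\Lambda$ of $h$ is locally maximal if there is a neighborhood $U$ of $\Lambda$ with $\Lambda=\bigcap_{n\in\mathbb Z}h^n(U)$. -/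

import Mathlib

open Bundle
open scoped Manifold ContDiff Topology

namespace CommutingHyperbolic

section Manifold

variable {E : Type*} [NormedAddCommGroup E] [NormedSpace ℝ E]
  {M : Type*} [MetricSpace M] [ChartedSpace E M] {r : WithTop ℕ∞}

/-- The centralizer `Z(f)` of `f` in the set of `C^r` diffeomorphisms of `M`. -/
def centralizer (f : M ≃ₘ^r⟮𝓘(ℝ, E), 𝓘(ℝ, E)⟯ M) : Set (M ≃ₘ^r⟮𝓘(ℝ, E), 𝓘(ℝ, E)⟯ M) :=
  {g | ∀ x, f (g x) = g (f x)}

/-- There is an `ε`-chain `x = c 0, c 1, …, c n = y` for `f`, of length `n ≥ 1`. -/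
def HasChain (f : M → M) (ε : ℝ) (x y : M) : Prop :=
  ∃ (n : ℕ) (c : ℕ → M), 1 ≤ n ∧ c 0 = x ∧ c n = y ∧
    ∀ j, 1 ≤ j → j ≤ n → dist (f (c (j - 1))) (c j) < ε

/-- The chain recurrent set `R(f)`. -/
def chainRecurrentSet (f : M → M) : Set M :=
  {x | ∀ ε > 0, HasChain f ε x x}

/-- The chain recurrent class of a point `x`. -/
def chainRecurrentClass (f : M → M) (x : M) : Set M :=
  {y | y ∈ chainRecurrentSet f ∧ ∀ ε > 0, HasChain f ε x y ∧ HasChain f ε y x}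

/-- `Λ` is a chain recurrent class of `f`: the class of some chain recurrent point. -/
def IsChainRecurrentClass (f : M → M) (Λ : Set M) : Prop :=
  ∃ x ∈ chainRecurrentSet f, Λ = chainRecurrentClass f x

/-- `f|Λ` is (topologically) mixing. The nonempty relatively open subsets of `Λ` are the sets
`U ∩ Λ ≠ ∅` with `U` open in `M`. -/
def IsMixingOn (f : M → M) (Λ : Set M) : Prop :=
  ∀ U V : Set M, IsOpen U → IsOpen V → (U ∩ Λ).Nonempty → (V ∩ Λ).Nonempty →
    ∃ N : ℕ, ∀ n ≥ N, ((f^[n] '' (U ∩ Λ)) ∩ (V ∩ Λ)).Nonempty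

/-- `Λ` is a hyperbolic set of the diffeomorphism `f`: it is compact and `f`-invariant, and there
is a `Df`-invariant splitting `T_x M = E^u_x ⊕ E^s_x`, `x ∈ Λ`, together with uniform constants
`C > 0` and `0 < lam < 1`, such that `Df^n` contracts `E^s` and `Df^{-n}` contracts `E^u` at rate
`C * lam ^ n`. Norms are those of the given Riemannian metric. -/
def IsHyperbolicSet [RiemannianBundle (fun x : M ↦ TangentSpace 𝓘(ℝ, E) x)]
    (f : M ≃ₘ^r⟮𝓘(ℝ, E), 𝓘(ℝ, E)⟯ M) (Λ : Set M) : Prop :=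
  IsCompact Λ ∧ f '' Λ = Λ ∧
    ∃ (Es Eu : ∀ x : M, Submodule ℝ (TangentSpace 𝓘(ℝ, E) x)) (C lam : ℝ),
      0 < C ∧ 0 < lam ∧ lam < 1 ∧ ∀ x ∈ Λ,
        IsCompl (Eu x) (Es x) ∧
        (mfderiv 𝓘(ℝ, E) 𝓘(ℝ, E) f x) '' (Es x : Set (TangentSpace 𝓘(ℝ, E) x)) = Es (f x) ∧
        (mfderiv 𝓘(ℝ, E) 𝓘(ℝ, E) f x) '' (Eu x : Set (TangentSpace 𝓘(ℝ, E) x)) = Eu (f x) ∧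
        (∀ (n : ℕ), ∀ v ∈ Es x,
          ‖mfderiv 𝓘(ℝ, E) 𝓘(ℝ, E) (f^[n]) x v‖ ≤ C * lam ^ n * ‖v‖) ∧
        (∀ (n : ℕ), ∀ v ∈ Eu x,
          ‖mfderiv 𝓘(ℝ, E) 𝓘(ℝ, E) (f.symm^[n]) x v‖ ≤ C * lam ^ n * ‖v‖)

/-- `Λ` is a locally maximal hyperbolic set of `f`: it is hyperbolic, and it is the maximal
invariant set `⋂_{n ∈ ℤ} f^n(U)` of some neighborhood `U` of `Λ`. -/
def IsLocallyMaximalHyperbolicSet [RiemannianBundle (fun x : M ↦ TangentSpace 𝓘(ℝ, E) x)]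
    (f : M ≃ₘ^r⟮𝓘(ℝ, E), 𝓘(ℝ, E)⟯ M) (Λ : Set M) : Prop :=
  IsHyperbolicSet f Λ ∧
    ∃ U ∈ 𝓝ˢ Λ, Λ = ⋂ n : ℤ, (((f.toEquiv : Equiv.Perm M) ^ n : Equiv.Perm M) : M → M) '' U

end Manifold

end CommutingHyperbolic

/-! Hyperbolicity enters only through one consequence: over `Λ`, no nonzero tangent vector has a
bounded two-sided orbit under the derivative. A compactness argument turns this into a uniform
statement along pseudo-orbits (`ChartCover.exists_lower_bound`). That statement gives expansivity
near `Λ`, closing of periodic pseudo-orbits in `Λ`, and nondegeneracy of periodic orbits near `Λ`.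
In the closing lemma the linearized problem lives on a finite-dimensional space of periodic
sequences, so injectivity already yields the inverse.

Periodic points pass between `f` and `g` as follows. If `q` is a nondegenerate fixed point of `k`
and a diffeomorphism commutes with `k`, its iterates of `q` are fixed points of `k` with the same
nonzero value of `det (1 - Dk)`. Such points are isolated and their limits are of the same kind, so
there are finitely many and `q` is periodic (`exists_iterate_eq_of_commute`).

For `f`, mixing lets pseudo-orbits in `Λ` be closed up. With closing, expansivity and the chain
class property, every `f`-orbit near `Λ` lies in `Λ`, and `f`-periodic points are dense in `Λ`.
These points are `g`-periodic, so `g`-pseudo-orbits in `Λ` can be closed up too. Hence `g`-orbits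
near `Λ` are limits of `g`-periodic points near `Λ`, which are in turn `f`-periodic.

Let `K` be the closed set of points whose `g`-orbit stays near `Λ`; it then lies in the closure of
the `f`-periodic points. A point of `K` whose `f`-orbit stays in `K` in forward or in backward time
accumulates on `Λ`, because any limit orbit stays near `Λ`. A nearby `f`-periodic orbit gives chains
in both directions, so the point is in `Λ` (`mem_of_tail_nearSet`). If `Λ` were not locally maximal
for `g`, points outside `Λ` with `g`-orbits ever closer to `Λ` would leave `K` under `f` after ever
longer times. Limits at the exit times give an `f`-orbit that is in `K` at all negative times and
off `Λ` at time zero, a contradiction (`exists_nearSet_subset_of_commute`). -/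

namespace CommutingHyperbolic

open Set Filter

/-! ### Derivatives and maps read in charts -/

section Charts

variable {E : Type*} [NormedAddCommGroup E] [NormedSpace ℝ E]
  {M : Type*} [MetricSpace M] [ChartedSpace E M]

/-- The derivative of `k : M → M` at `x`, as an endomorphism of the model space. -/
noncomputable def tder (k : M → M) (x : M) : E →L[ℝ] E := mfderiv 𝓘(ℝ, E) 𝓘(ℝ, E) k x

/-- The derivative at `x` of the chart centered at `a`, as an endomorphism of the model space. -/
noncomputable def chartDer (a x : M) : E →L[ℝ] E := mfderiv 𝓘(ℝ, E) 𝓘(ℝ, E) (extChartAt 𝓘(ℝ, E) a) x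

/-- The Riemannian norm at `x` of a vector of the model space. -/
noncomputable def riemNorm [RiemannianBundle (fun x : M ↦ TangentSpace 𝓘(ℝ, E) x)] (x : M) (v : E) : ℝ :=
  ‖(show TangentSpace 𝓘(ℝ, E) x from v)‖

/-- The expression of `k : M → M` in the charts centered at `a` and `b`. -/
noncomputable def locMap (E : Type*) [NormedAddCommGroup E] [NormedSpace ℝ E] [ChartedSpace E M]
    (k : M → M) (a b : M) (u : E) : E :=
  extChartAt 𝓘(ℝ, E) b (k ((extChartAt 𝓘(ℝ, E) a).symm u))

theorem tder_comp {k l : M → M} (hk : ContMDiff 𝓘(ℝ, E) 𝓘(ℝ, E) 1 k)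
    (hl : ContMDiff 𝓘(ℝ, E) 𝓘(ℝ, E) 1 l) (x : M) :
    tder (E := E) (k ∘ l) x = (tder k (l x)).comp (tder l x) :=
  mfderiv_comp x (hk.mdifferentiableAt one_ne_zero) (hl.mdifferentiableAt one_ne_zero)

theorem tder_id (x : M) : tder (E := E) (id : M → M) x = ContinuousLinearMap.id ℝ E :=
  mfderiv_id

/-- The open set on which `locMap E k a b` is meaningful. -/
def locDom (E : Type*) [NormedAddCommGroup E] [NormedSpace ℝ E] [ChartedSpace E M]
    (k : M → M) (a b : M) : Set E :=
  (extChartAt 𝓘(ℝ, E) a).target ∩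
    (extChartAt 𝓘(ℝ, E) a).symm ⁻¹' (k ⁻¹' (extChartAt 𝓘(ℝ, E) b).source)

theorem isOpen_locDom {k : M → M} (hk : Continuous k) (a b : M) : IsOpen (locDom E k a b) :=
  (continuousOn_extChartAt_symm a).isOpen_inter_preimage (isOpen_extChartAt_target a)
    ((isOpen_extChartAt_source b).preimage hk)

theorem mem_locDom {k : M → M} {a b x : M} (hx : x ∈ (extChartAt 𝓘(ℝ, E) a).source)
    (hkx : k x ∈ (extChartAt 𝓘(ℝ, E) b).source) : extChartAt 𝓘(ℝ, E) a x ∈ locDom E k a b :=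
  ⟨(extChartAt 𝓘(ℝ, E) a).map_source hx, by
    simpa only [mem_preimage, (extChartAt 𝓘(ℝ, E) a).left_inv hx] using hkx⟩

variable [IsManifold 𝓘(ℝ, E) ∞ M]

theorem chartDer_injective {a x : M} (hx : x ∈ (extChartAt 𝓘(ℝ, E) a).source) :
    Function.Injective (chartDer (E := E) a x) :=
  (isInvertible_mfderiv_extChartAt (I := 𝓘(ℝ, E)) hx).injective

theorem chartDer_surjective {a x : M} (hx : x ∈ (extChartAt 𝓘(ℝ, E) a).source) :
    Function.Surjective (chartDer (E := E) a x) :=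
  (isInvertible_mfderiv_extChartAt (I := 𝓘(ℝ, E)) hx).surjective

theorem contDiffOn_locMap {k : M → M} (hk : ContMDiff 𝓘(ℝ, E) 𝓘(ℝ, E) 1 k) (a b : M) :
    ContDiffOn ℝ 1 (locMap E k a b) (locDom E k a b) := by
  rw [← contMDiffOn_iff_contDiffOn]
  refine (contMDiffOn_extChartAt (I := 𝓘(ℝ, E)) (n := 1) (x := b)).comp
    (hk.comp_contMDiffOn ((contMDiffOn_extChartAt_symm (I := 𝓘(ℝ, E)) (n := 1) a).mono
      inter_subset_left)) ?_
  intro u hu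
  simpa using hu.2

theorem fderiv_locMap {k : M → M} (hk : ContMDiff 𝓘(ℝ, E) 𝓘(ℝ, E) 1 k) {a b x : M}
    (hx : x ∈ (extChartAt 𝓘(ℝ, E) a).source) (hkx : k x ∈ (extChartAt 𝓘(ℝ, E) b).source) (v : E) :
    fderiv ℝ (locMap E k a b) (extChartAt 𝓘(ℝ, E) a x) (chartDer a x v) =
      chartDer b (k x) (tder k x v) := by
  have hmem := mem_locDom hx hkx
  have hd : DifferentiableAt ℝ (locMap E k a b) (extChartAt 𝓘(ℝ, E) a x) :=
    ((contDiffOn_locMap hk a b).contDiffAt ((isOpen_locDom hk.continuous a b).mem_nhds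
      hmem)).differentiableAt one_ne_zero
  have ha : MDifferentiableAt 𝓘(ℝ, E) 𝓘(ℝ, E) (extChartAt 𝓘(ℝ, E) a) x :=
    mdifferentiableAt_extChartAt (by simpa using hx)
  have hb : MDifferentiableAt 𝓘(ℝ, E) 𝓘(ℝ, E) (extChartAt 𝓘(ℝ, E) b) (k x) :=
    mdifferentiableAt_extChartAt (by simpa using hkx)
  have hkd : MDifferentiableAt 𝓘(ℝ, E) 𝓘(ℝ, E) k x := hk.mdifferentiableAt one_ne_zero
  have h1 := mfderiv_comp x hd.mdifferentiableAt ha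
  have h2 := mfderiv_comp x hb hkd
  have h3 : (locMap E k a b ∘ extChartAt 𝓘(ℝ, E) a) =ᶠ[𝓝 x] (extChartAt 𝓘(ℝ, E) b ∘ k) := by
    filter_upwards [extChartAt_source_mem_nhds' hx] with y hy
    simp only [locMap, Function.comp_apply, (extChartAt 𝓘(ℝ, E) a).left_inv hy]
  have h4 := h3.mfderiv_eq (I := 𝓘(ℝ, E)) (I' := 𝓘(ℝ, E))
  rw [h1, h2, mfderiv_eq_fderiv] at h4
  exact congrArg (fun L : E →L[ℝ] E ↦ L v) h4

/-- The tangent bundle trivialization at `a` is the derivative of the chart, and its inverse is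
locally bounded for a continuous metric. This direction suffices to turn boundedness in charts into
boundedness of Riemannian norms. -/
theorem exists_riemNorm_le [RiemannianBundle (fun x : M ↦ TangentSpace 𝓘(ℝ, E) x)]
    [IsContinuousRiemannianBundle E (fun x : M ↦ TangentSpace 𝓘(ℝ, E) x)] (a : M) :
    ∃ C > 0, ∀ᶠ x in 𝓝 a, ∀ v : E, riemNorm x v ≤ C * ‖chartDer a x v‖ := by
  obtain ⟨C, C0, hC⟩ :=
    eventually_norm_symmL_trivializationAt_lt E (fun x : M ↦ TangentSpace 𝓘(ℝ, E) x) a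
  refine ⟨C, C0, ?_⟩
  filter_upwards [hC, chart_source_mem_nhds E a] with x hx hxs v
  have h1 := TangentBundle.continuousLinearMapAt_trivializationAt (I := 𝓘(ℝ, E)) hxs
  have h2 : (trivializationAt E (TangentSpace 𝓘(ℝ, E)) a).symmL ℝ x
      ((trivializationAt E (TangentSpace 𝓘(ℝ, E)) a).continuousLinearMapAt ℝ x
        (show TangentSpace 𝓘(ℝ, E) x from v)) = v :=
    Trivialization.symmL_continuousLinearMapAt _ (by simpa using hxs) _
  have h3 := ((trivializationAt E (TangentSpace 𝓘(ℝ, E)) a).symmL ℝ x).le_of_opNorm_le hx.le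
    ((trivializationAt E (TangentSpace 𝓘(ℝ, E)) a).continuousLinearMapAt ℝ x
        (show TangentSpace 𝓘(ℝ, E) x from v))
  rw [h2, h1] at h3
  exact h3

end Charts

/-! ### Limits along ultrafilters -/

theorem exists_tendsto_ultrafilter {ι X : Type*} [TopologicalSpace X] {K : Set X}
    (hK : IsCompact K) (U : Ultrafilter ι) {f : ι → X} (hf : ∀ᶠ j in (U : Filter ι), f j ∈ K) :
    ∃ x ∈ K, Tendsto f U (𝓝 x) :=
  isCompact_iff_ultrafilter_le_nhds'.1 hK (U.map f) hf

theorem exists_eventually_eq_ultrafilter {ι X : Type*} (t : Finset X) (U : Ultrafilter ι)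
    {f : ι → X} (hf : ∀ j, f j ∈ t) : ∃ a ∈ t, ∀ᶠ j in (U : Filter ι), f j = a := by
  have h : (⋃ a ∈ (t : Set X), f ⁻¹' {a}) ∈ U :=
    Filter.univ_mem' fun j ↦ by simpa using hf j
  obtain ⟨a, ha, h'⟩ := (Ultrafilter.finite_biUnion_mem_iff t.finite_toSet).1 h
  exact ⟨a, ha, h'⟩

/-! ### Bounded orbits of the derivative cocycle -/

section Cocycle

variable {E : Type*} [NormedAddCommGroup E] [NormedSpace ℝ E]
  {M : Type*} [MetricSpace M] [ChartedSpace E M]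

theorem contMDiff_iterate {k : M → M} (hk : ContMDiff 𝓘(ℝ, E) 𝓘(ℝ, E) 1 k) (n : ℕ) :
    ContMDiff 𝓘(ℝ, E) 𝓘(ℝ, E) 1 (k^[n]) := by
  induction n with
  | zero => exact contMDiff_id
  | succ n ih => exact ih.comp hk

section Norm

variable [RiemannianBundle (fun x : M ↦ TangentSpace 𝓘(ℝ, E) x)]

theorem riemNorm_nonneg (x : M) (v : E) : 0 ≤ riemNorm x v :=
  norm_nonneg (show TangentSpace 𝓘(ℝ, E) x from v)

theorem eq_zero_of_riemNorm_le_zero {x : M} {v : E} (h : riemNorm x v ≤ 0) : v = 0 :=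
  norm_le_zero_iff (a := (show TangentSpace 𝓘(ℝ, E) x from v)).1 h

theorem riemNorm_le_add (x : M) (v w : E) : riemNorm x v ≤ riemNorm x (v + w) + riemNorm x w := by
  have h := norm_sub_le (show TangentSpace 𝓘(ℝ, E) x from (v + w : E))
    (show TangentSpace 𝓘(ℝ, E) x from w)
  have h' : ((show TangentSpace 𝓘(ℝ, E) x from (v + w : E)) - (show TangentSpace 𝓘(ℝ, E) x from w))
    = (show TangentSpace 𝓘(ℝ, E) x from v) := add_sub_cancel_right (G := E) v w
  rw [h'] at h
  exact h

/-- A vector with bounded `k`-orbit lying in a `k`-invariant family of subspaces that is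
contracted by the inverse `l` of `k` vanishes. -/
theorem eq_zero_of_bounded_of_contracted {k l : M → M}
    (hk : ContMDiff 𝓘(ℝ, E) 𝓘(ℝ, E) 1 k) (hl : ContMDiff 𝓘(ℝ, E) 𝓘(ℝ, E) 1 l)
    (hlk : ∀ x, l (k x) = x) {Λ : Set M} (hΛ : MapsTo k Λ Λ) {F : M → Submodule ℝ E}
    (hF : ∀ x ∈ Λ, ∀ v ∈ F x, tder k x v ∈ F (k x)) {C lam : ℝ} (h0 : 0 < lam)
    (h1 : lam < 1)
    (hc : ∀ x ∈ Λ, ∀ (n : ℕ), ∀ v ∈ F x,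
      riemNorm (l^[n] x) (tder (l^[n]) x v) ≤ C * lam ^ n * riemNorm x v)
    (hC : 0 < C) {x : M} (hx : x ∈ Λ) {v : E} (hv : v ∈ F x) {B : ℝ}
    (hB : ∀ n : ℕ, riemNorm (k^[n] x) (tder (k^[n]) x v) ≤ B) : v = 0 := by
  have hinv : ∀ n : ℕ, k^[n] x ∈ Λ ∧ tder (k^[n]) x v ∈ F (k^[n] x) := by
    intro n
    induction n with
    | zero => exact ⟨hx, by simpa [tder_id, Function.iterate_zero] using hv⟩
    | succ n ih =>
      rw [Function.iterate_succ']
      refine ⟨hΛ ih.1, ?_⟩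
      rw [tder_comp hk (contMDiff_iterate hk n)]
      exact hF _ ih.1 _ ih.2
  have hle : ∀ n : ℕ, riemNorm x v ≤ C * lam ^ n * B := by
    intro n
    have h2 : l^[n] (k^[n] x) = x := (Function.LeftInverse.iterate hlk n) x
    have h3 : tder (l^[n]) (k^[n] x) (tder (k^[n]) x v) = v := by
      have := tder_comp (contMDiff_iterate hl n) (contMDiff_iterate hk n) x
      have h4 : l^[n] ∘ k^[n] = id := funext (Function.LeftInverse.iterate hlk n)
      rw [h4, tder_id] at this
      exact (congrArg (fun L : E →L[ℝ] E ↦ L v) this).symm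
    have h5 := hc _ (hinv n).1 n _ (hinv n).2
    rw [h2, h3] at h5
    exact h5.trans (mul_le_mul_of_nonneg_left (hB n) (by positivity))
  refine eq_zero_of_riemNorm_le_zero (x := x) (ge_of_tendsto'
    (f := fun n : ℕ ↦ C * lam ^ n * B) (x := atTop) ?_ hle)
  have := ((tendsto_pow_atTop_nhds_zero_of_lt_one h0.le h1).const_mul C).mul_const B
  simpa using this

end Norm

theorem contMDiff_zpow {r : WithTop ℕ∞} (hr : 1 ≤ r) (h : M ≃ₘ^r⟮𝓘(ℝ, E), 𝓘(ℝ, E)⟯ M) (n : ℤ) :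
    ContMDiff 𝓘(ℝ, E) 𝓘(ℝ, E) 1 ⇑((h.toEquiv : Equiv.Perm M) ^ n) := by
  induction n with
  | zero => exact contMDiff_id
  | succ n ih =>
    rw [zpow_add_one]
    exact ih.comp (h.contMDiff.of_le hr)
  | pred n ih =>
    rw [zpow_sub_one]
    exact ih.comp (h.symm.contMDiff.of_le hr)

/-- The hyperbolic splitting, with tangent spaces identified with the model space. -/
theorem IsHyperbolicSet.exists_splitting [RiemannianBundle (fun x : M ↦ TangentSpace 𝓘(ℝ, E) x)]
    {r : WithTop ℕ∞} {h : M ≃ₘ^r⟮𝓘(ℝ, E), 𝓘(ℝ, E)⟯ M} {Λ : Set M} (hyp : IsHyperbolicSet h Λ) :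
    ∃ (Es Eu : M → Submodule ℝ E) (C lam : ℝ), 0 < C ∧ 0 < lam ∧ lam < 1 ∧ ∀ x ∈ Λ,
      Eu x ⊔ Es x = ⊤ ∧ tder h x '' (Es x : Set E) = (Es (h x) : Set E) ∧
      tder h x '' (Eu x : Set E) = (Eu (h x) : Set E) ∧
      (∀ (n : ℕ), ∀ v ∈ Es x,
        riemNorm (h^[n] x) (tder (h^[n]) x v) ≤ C * lam ^ n * riemNorm x v) ∧
      (∀ (n : ℕ), ∀ v ∈ Eu x,
        riemNorm (h.symm^[n] x) (tder (h.symm^[n]) x v) ≤ C * lam ^ n * riemNorm x v) := by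
  obtain ⟨-, -, Es, Eu, C, lam, hC, h0, h1, H⟩ := hyp
  exact ⟨Es, Eu, C, lam, hC, h0, h1, fun x hx ↦ ⟨(H x hx).1.sup_eq_top, (H x hx).2⟩⟩

/-- Forward iterates of the stable component are bounded, hence so are those of the unstable
component, which therefore vanishes. What remains is a stable vector with bounded backward orbit,
and it vanishes too. -/
theorem eq_zero_of_bounded [RiemannianBundle (fun x : M ↦ TangentSpace 𝓘(ℝ, E) x)]
    {r : WithTop ℕ∞} (hr : 1 ≤ r) {h : M ≃ₘ^r⟮𝓘(ℝ, E), 𝓘(ℝ, E)⟯ M}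
    {Λ : Set M} (hyp : IsHyperbolicSet h Λ) {x : M} (hx : x ∈ Λ) {v : E} {B : ℝ}
    (hB : ∀ n : ℤ, riemNorm (((h.toEquiv : Equiv.Perm M) ^ n) x)
      (tder ((h.toEquiv : Equiv.Perm M) ^ n) x v) ≤ B) : v = 0 := by
  obtain ⟨Es, Eu, C, lam, hC, h0, h1, H⟩ := hyp.exists_splitting
  have hinv := hyp.2.1
  have hk : ContMDiff 𝓘(ℝ, E) 𝓘(ℝ, E) 1 h := h.contMDiff.of_le hr
  have hl : ContMDiff 𝓘(ℝ, E) 𝓘(ℝ, E) 1 h.symm := h.symm.contMDiff.of_le hr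
  have hmaps : MapsTo h Λ Λ := fun y hy ↦ hinv ▸ mem_image_of_mem h hy
  have hmaps' : MapsTo h.symm Λ Λ := by
    intro y hy
    rw [← hinv] at hy
    obtain ⟨z, hz, rfl⟩ := hy
    simpa using hz
  have hpos : ∀ n : ℕ, ⇑((h.toEquiv : Equiv.Perm M) ^ (n : ℤ)) = h^[n] := fun n ↦ by
    rw [zpow_natCast, ← Equiv.Perm.iterate_eq_pow]; rfl
  have hneg : ∀ n : ℕ, ⇑((h.toEquiv : Equiv.Perm M) ^ (-(n : ℤ))) = h.symm^[n] := fun n ↦ by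
    rw [zpow_neg, zpow_natCast, ← inv_pow, ← Equiv.Perm.iterate_eq_pow]; rfl
  obtain ⟨vu, hvu, vs, hvs, rfl⟩ : ∃ vu ∈ Eu x, ∃ vs ∈ Es x, vu + vs = v :=
    Submodule.mem_sup.1 ((H x hx).1 ▸ Submodule.mem_top)
  have hFu : ∀ x ∈ Λ, ∀ v ∈ Eu x, tder h x v ∈ Eu (h x) := fun y hy v hv ↦ by
    have h2 := (H y hy).2.2.1
    exact (Set.ext_iff.1 h2 _).1 ⟨v, hv, rfl⟩
  have hFs : ∀ x ∈ Λ, ∀ v ∈ Es x, tder h.symm x v ∈ Es (h.symm x) := fun y hy v hv ↦ by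
    obtain ⟨z, rfl⟩ : ∃ z, h z = y := h.surjective y
    have hz : z ∈ Λ := by simpa using hmaps' hy
    obtain ⟨w, hw, hwv⟩ := (Set.ext_iff.1 (H z hz).2.1 v).2 hv
    have h3 : tder h.symm (h z) (tder h z w) = w := by
      have := tder_comp hl hk z
      have h4 : ⇑h.symm ∘ ⇑h = id := funext h.symm_apply_apply
      rw [h4, tder_id] at this
      exact (congrArg (fun L : E →L[ℝ] E ↦ L w) this).symm
    have h5 : tder h z w = v := hwv
    rw [← h5, h3, h.symm_apply_apply]
    exact hw
  have hvu0 : vu = 0 := by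
    refine eq_zero_of_bounded_of_contracted hk hl h.symm_apply_apply hmaps (F := Eu) hFu h0 h1
      (fun y hy n v hv ↦ (H y hy).2.2.2.2 n v hv) hC hx hvu (B := B + C * riemNorm x vs) ?_
    intro n
    refine (riemNorm_le_add _ _ (tder (h^[n]) x vs)).trans (add_le_add ?_ ?_)
    · have := hB n
      rw [hpos] at this
      rw [← map_add]
      exact this
    · refine ((H x hx).2.2.2.1 n vs hvs).trans ?_
      have h6 : lam ^ n ≤ 1 := pow_le_one₀ h0.le h1.le
      refine mul_le_mul_of_nonneg_right ?_ (riemNorm_nonneg x vs)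
      exact (mul_le_mul_of_nonneg_left h6 hC.le).trans (mul_one C).le
  have hvs0 : vs = 0 := by
    refine eq_zero_of_bounded_of_contracted hl hk h.apply_symm_apply hmaps' (F := Es) hFs h0 h1
      (fun y hy n v hv ↦ (H y hy).2.2.2.1 n v hv) hC hx hvs (B := B) ?_
    intro n
    have := hB (-n)
    rw [hneg, hvu0, zero_add] at this
    exact this
  rw [hvu0, hvs0, add_zero]

end Cocycle

/-! ### Finite chart covers with a Lebesgue number -/

section Cover

variable (E : Type*) [NormedAddCommGroup E] [NormedSpace ℝ E]
  (M : Type*) [MetricSpace M] [ChartedSpace E M]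
  [RiemannianBundle (fun x : M ↦ TangentSpace 𝓘(ℝ, E) x)]

/-- A finite family of chart domains with a Lebesgue number `δ` and a uniform bound for the
Riemannian norm in terms of the charts. -/
structure ChartCover where
  centers : Finset M
  dom : M → Set M
  δ : ℝ
  bound : ℝ
  δ_pos : 0 < δ
  bound_pos : 0 < bound
  dom_subset : ∀ a ∈ centers, dom a ⊆ (extChartAt 𝓘(ℝ, E) a).source
  norm_le : ∀ a ∈ centers, ∀ x ∈ dom a, ∀ v : E, riemNorm x v ≤ bound * ‖chartDer a x v‖
  exists_ball : ∀ x, ∃ a ∈ centers, Metric.ball x δ ⊆ dom a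

theorem exists_chartCover [CompactSpace M] [IsManifold 𝓘(ℝ, E) ∞ M]
    [IsContinuousRiemannianBundle E (fun x : M ↦ TangentSpace 𝓘(ℝ, E) x)] :
    Nonempty (ChartCover E M) := by
  choose C hC hev using fun a : M ↦ exists_riemNorm_le (E := E) a
  choose O hO hOopen haO using fun a : M ↦
    mem_nhds_iff.1 (inter_mem (hev a) (extChartAt_source_mem_nhds (I := 𝓘(ℝ, E)) a))
  obtain ⟨t, ht⟩ := isCompact_univ.elim_finite_subcover O hOopen
    (fun x _ ↦ mem_iUnion.2 ⟨x, haO x⟩)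
  obtain ⟨δ, hδ, hball⟩ := lebesgue_number_lemma_of_metric (s := (univ : Set M))
    (c := fun a : t ↦ O a) isCompact_univ (fun a ↦ hOopen a)
    (by simpa [iUnion_subtype] using ht)
  -- The sum dominates each local constant; adding one keeps the bound positive even for empty `t`.
  refine ⟨⟨t, O, δ, ∑ a ∈ t, C a + 1, hδ, ?_, fun a _ x hx ↦ (hO a hx).2, ?_, ?_⟩⟩
  · have := Finset.sum_nonneg (fun a (_ : a ∈ t) ↦ (hC a).le)
    linarith
  · intro a ha x hx v
    refine ((hO a hx).1 v).trans (mul_le_mul_of_nonneg_right ?_ (norm_nonneg _))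
    have := Finset.single_le_sum (fun a (_ : a ∈ t) ↦ (hC a).le) ha
    linarith
  · intro x
    obtain ⟨a, ha⟩ := hball x (mem_univ x)
    exact ⟨a, a.2, ha⟩

variable {E M}

/-- The points whose `δ`-ball lies in the domain of index `a`. -/
def ChartCover.core (c : ChartCover E M) (a : M) : Set M := {x | Metric.ball x c.δ ⊆ c.dom a}

/-- Closedness makes a limit of points with a fixed chart index keep that index, and provides the
compact sets on which chart estimates are uniform. -/
theorem ChartCover.isClosed_core (c : ChartCover E M) (a : M) : IsClosed (c.core a) := by
  have : c.core a = ⋂ y ∈ (c.dom a)ᶜ, {x | c.δ ≤ dist y x} := by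
    ext x
    simp only [core, mem_ofPred_eq, mem_iInter, mem_compl_iff, subset_def, Metric.mem_ball]
    exact ⟨fun h y hy ↦ not_lt.1 fun h' ↦ hy (h y h'), fun h y hy ↦ by_contra fun h' ↦
      absurd hy (not_lt.2 (h y h'))⟩
  rw [this]
  exact isClosed_biInter fun y _ ↦ isClosed_le continuous_const (continuous_const.dist continuous_id)

theorem ChartCover.mem_source (c : ChartCover E M) {a x y : M} (ha : a ∈ c.centers)
    (hx : x ∈ c.core a) (hy : dist y x < c.δ) : y ∈ (extChartAt 𝓘(ℝ, E) a).source :=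
  c.dom_subset a ha (hx hy)

theorem ChartCover.mem_source_self (c : ChartCover E M) {a x : M} (ha : a ∈ c.centers)
    (hx : x ∈ c.core a) : x ∈ (extChartAt 𝓘(ℝ, E) a).source :=
  c.mem_source ha hx (by simpa using c.δ_pos)

end Cover

/-! ### Uniform absence of bounded orbits along pseudo-orbits -/

section LowerBound

variable {E : Type*} [NormedAddCommGroup E] [NormedSpace ℝ E]
  {M : Type*} [MetricSpace M] [ChartedSpace E M] [IsManifold 𝓘(ℝ, E) ∞ M]

theorem continuousAt_fderiv_locMap {k : M → M} (hk : ContMDiff 𝓘(ℝ, E) 𝓘(ℝ, E) 1 k) {a b : M}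
    {u : E} (hu : u ∈ locDom E k a b) : ContinuousAt (fderiv ℝ (locMap E k a b)) u :=
  ((contDiffOn_locMap hk a b).continuousOn_fderiv_of_isOpen (isOpen_locDom hk.continuous a b)
    le_rfl).continuousAt ((isOpen_locDom hk.continuous a b).mem_nhds hu)

variable [RiemannianBundle (fun x : M ↦ TangentSpace 𝓘(ℝ, E) x)]

/-- An orbit of the derivative cocycle over `Λ` that is bounded in charts vanishes. -/
theorem ChartCover.eq_zero_of_bounded (c : ChartCover E M)
    {r : WithTop ℕ∞} (hr : 1 ≤ r) {h : M ≃ₘ^r⟮𝓘(ℝ, E), 𝓘(ℝ, E)⟯ M}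
    {Λ : Set M} (hyp : IsHyperbolicSet h Λ) {x i : ℤ → M} {w : ℤ → E} {S : ℝ}
    (hx : x 0 ∈ Λ) (hi : ∀ n, i n ∈ c.centers) (hxi : ∀ n, x n ∈ c.core (i n))
    (hhx : ∀ n, h (x n) = x (n + 1)) (hw : ∀ n, ‖w n‖ ≤ S)
    (hhw : ∀ n, w (n + 1) =
      fderiv ℝ (locMap E h (i n) (i (n + 1))) (extChartAt 𝓘(ℝ, E) (i n) (x n)) (w n)) :
    w 0 = 0 := by
  have hk : ContMDiff 𝓘(ℝ, E) 𝓘(ℝ, E) 1 h := h.contMDiff.of_le hr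
  have hsrc n : x n ∈ (extChartAt 𝓘(ℝ, E) (i n)).source := c.mem_source_self (hi n) (hxi n)
  choose v hv using fun n ↦ chartDer_surjective (hsrc n) (w n)
  have hstep : ∀ n, v (n + 1) = tder h (x n) (v n) := by
    intro n
    refine chartDer_injective (hsrc (n + 1)) ?_
    have h2 : h (x n) ∈ (extChartAt 𝓘(ℝ, E) (i (n + 1))).source := by
      rw [hhx]; exact hsrc _
    have h1 := fderiv_locMap hk (hsrc n) h2 (v n)
    rw [hv n, ← hhw n, hhx] at h1
    rw [hv, h1]
  have hxn : ∀ n : ℤ, x n = ((h.toEquiv : Equiv.Perm M) ^ n) (x 0) ∧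
      v n = tder ((h.toEquiv : Equiv.Perm M) ^ n) (x 0) (v 0) := by
    intro n
    induction n with
    | zero =>
      refine ⟨rfl, ?_⟩
      exact (congrArg (fun L : E →L[ℝ] E ↦ L (v 0)) (tder_id (x 0))).symm
    | succ n ih =>
      have e : ((h.toEquiv : Equiv.Perm M) ^ ((n : ℤ) + 1)) =
        (h.toEquiv : Equiv.Perm M) * (h.toEquiv : Equiv.Perm M) ^ (n : ℤ) := by
          rw [add_comm, zpow_add, zpow_one]
      rw [e]
      refine ⟨?_, ?_⟩
      · rw [← hhx, ih.1]; rfl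
      · rw [hstep, ih.2, ih.1]
        have := tder_comp hk (contMDiff_zpow hr h n) (x 0)
        exact (congrArg (fun L : E →L[ℝ] E ↦ L (v 0)) this).symm
    | pred n ih =>
      have hl : ContMDiff 𝓘(ℝ, E) 𝓘(ℝ, E) 1 h.symm := h.symm.contMDiff.of_le hr
      have e : ((h.toEquiv : Equiv.Perm M) ^ (-(n : ℤ) - 1)) =
        (h.toEquiv : Equiv.Perm M)⁻¹ * (h.toEquiv : Equiv.Perm M) ^ (-(n : ℤ)) := by
          rw [sub_eq_add_neg, add_comm, zpow_add, zpow_neg_one]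
      have h1 := hhx (-(n : ℤ) - 1)
      have h2 := hstep (-(n : ℤ) - 1)
      rw [sub_add_cancel] at h1 h2
      have h3 : x (-(n : ℤ) - 1) = h.symm (x (-(n : ℤ))) := by rw [← h1, h.symm_apply_apply]
      have h4 : v (-(n : ℤ) - 1) = tder h.symm (x (-(n : ℤ))) (v (-(n : ℤ))) := by
        rw [h2, ← h1]
        have := tder_comp hl hk (x (-(n : ℤ) - 1))
        have h5 : ⇑h.symm ∘ ⇑h = id := funext h.symm_apply_apply
        rw [h5, tder_id] at this
        exact congrArg (fun L : E →L[ℝ] E ↦ L (v (-(n : ℤ) - 1))) this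
      rw [e]
      refine ⟨?_, ?_⟩
      · rw [h3, ih.1]; rfl
      · rw [h4, ih.2, ih.1]
        have := tder_comp hl (contMDiff_zpow hr h (-(n : ℤ))) (x 0)
        exact (congrArg (fun L : E →L[ℝ] E ↦ L (v 0)) this).symm
  have h0 : v 0 = 0 := by
    refine CommutingHyperbolic.eq_zero_of_bounded hr hyp hx (B := c.bound * S) fun n ↦ ?_
    rw [← (hxn n).1, ← (hxn n).2]
    refine (c.norm_le _ (hi n) _ (hxi n (by simpa using c.δ_pos)) _).trans ?_
    rw [hv]
    exact mul_le_mul_of_nonneg_left (hw n) c.bound_pos.le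
  rw [← hv 0, h0, map_zero]

variable [FiniteDimensional ℝ E]

/-- Uniform form of the absence of bounded orbits of the derivative cocycle, along pseudo-orbits. -/
theorem ChartCover.exists_lower_bound (c : ChartCover E M)
    {r : WithTop ℕ∞} (hr : 1 ≤ r) {h : M ≃ₘ^r⟮𝓘(ℝ, E), 𝓘(ℝ, E)⟯ M}
    {Λ : Set M} (hyp : IsHyperbolicSet h Λ) :
    ∃ κ > 0, ∀ (x i : ℤ → M) (w : ℤ → E) (S : ℝ), (∀ n, x n ∈ Λ) → (∀ n, i n ∈ c.centers) →
      (∀ n, x n ∈ c.core (i n)) → (∀ n, dist (h (x n)) (x (n + 1)) < κ) → (∀ n, ‖w n‖ ≤ S) →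
      (∀ n, ‖w (n + 1) - fderiv ℝ (locMap E h (i n) (i (n + 1)))
        (extChartAt 𝓘(ℝ, E) (i n) (x n)) (w n)‖ ≤ κ * S) → ∀ n, ‖w n‖ ≤ S / 2 := by
  by_contra! hneg
  have hk : ContMDiff 𝓘(ℝ, E) 𝓘(ℝ, E) 1 h := h.contMDiff.of_le hr
  -- Take counterexamples with `κ = 1 / (j + 1)`, shift time so that the bad index `m j` becomes
  -- zero, and divide by `S j`. The ultralimit is a genuine orbit with a cocycle orbit bounded by
  -- one and of norm at least `1 / 2` at time zero.
  choose x i w S hx hi hxi hd hw hA m hm using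
    fun j : ℕ ↦ hneg (1 / ((j : ℝ) + 1)) Nat.one_div_pos_of_nat
  have hS : ∀ j, 0 < S j := fun j ↦ by
    have h1 := hw j (m j)
    have h2 := hm j
    by_contra! h3
    have h4 := norm_nonneg (w j (m j))
    linarith
  have hproper : ProperSpace E := FiniteDimensional.proper_real E
  let U : Ultrafilter ℕ := hyperfilter ℕ
  have hU : (U : Filter ℕ) ≤ atTop := by
    rw [← Nat.cofinite_eq_atTop]; exact hyperfilter_le_cofinite
  choose X hXΛ hX using fun n : ℤ ↦ exists_tendsto_ultrafilter hyp.1 U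
    (f := fun j ↦ x j (n + m j)) (Eventually.of_forall fun j ↦ hx j _)
  choose I hI hiI using fun n : ℤ ↦ exists_eventually_eq_ultrafilter c.centers U
    (f := fun j ↦ i j (n + m j)) (fun j ↦ hi j _)
  choose W hW1 hW using fun n : ℤ ↦ exists_tendsto_ultrafilter
    (isCompact_closedBall (0 : E) 1) U (f := fun j ↦ (S j)⁻¹ • w j (n + m j))
    (Eventually.of_forall fun j ↦ by
      rw [mem_closedBall_zero_iff, norm_smul, norm_inv, Real.norm_of_nonneg (hS j).le,
        inv_mul_le_one₀ (hS j)]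
      exact hw j _)
  have hone : Tendsto (fun j : ℕ ↦ 1 / ((j : ℝ) + 1)) U (𝓝 0) :=
    tendsto_one_div_add_atTop_nhds_zero_nat.mono_left hU
  have hadd : ∀ (n : ℤ) (j : ℕ), n + m j + 1 = n + 1 + m j := fun n j ↦ by ring
  have hhX : ∀ n, h (X n) = X (n + 1) := by
    intro n
    have h1 : Tendsto (fun j ↦ dist (h (x j (n + m j))) (x j (n + 1 + m j))) U
        (𝓝 (dist (h (X n)) (X (n + 1)))) :=
      ((hk.continuous.tendsto _).comp (hX n)).dist (hX (n + 1))
    refine dist_le_zero.1 (le_of_tendsto_of_tendsto' h1 hone fun j ↦ ?_)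
    rw [← hadd]
    exact (hd j _).le
  have hcore : ∀ n, X n ∈ c.core (I n) := by
    intro n
    refine (c.isClosed_core (I n)).mem_of_tendsto (hX n) ?_
    filter_upwards [hiI n] with j hj
    rw [← hj]; exact hxi j _
  have hsrc n : X n ∈ (extChartAt 𝓘(ℝ, E) (I n)).source := c.mem_source_self (hI n) (hcore n)
  have hhW : ∀ n, W (n + 1) =
      fderiv ℝ (locMap E h (I n) (I (n + 1))) (extChartAt 𝓘(ℝ, E) (I n) (X n)) (W n) := by
    intro n
    have h2 : h (X n) ∈ (extChartAt 𝓘(ℝ, E) (I (n + 1))).source := by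
      rw [hhX]; exact hsrc _
    have hA1 : Tendsto (fun j ↦ fderiv ℝ (locMap E h (I n) (I (n + 1)))
        (extChartAt 𝓘(ℝ, E) (I n) (x j (n + m j)))) U
        (𝓝 (fderiv ℝ (locMap E h (I n) (I (n + 1))) (extChartAt 𝓘(ℝ, E) (I n) (X n)))) :=
      ((continuousAt_fderiv_locMap hk (mem_locDom (hsrc n) h2)).tendsto.comp
        (continuousAt_extChartAt' (hsrc n))).comp (hX n)
    have hA2 := (hW (n + 1)).sub ((isBoundedBilinearMap_apply (𝕜 := ℝ)).continuous.tendsto _ |>.comp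
      (hA1.prodMk_nhds (hW n)))
    refine sub_eq_zero.1 (norm_le_zero_iff.1 (le_of_tendsto_of_tendsto hA2.norm hone ?_))
    filter_upwards [hiI n, hiI (n + 1)] with j hj hj'
    have h3 := hA j (n + m j)
    rw [hadd, hj, hj'] at h3
    simp only [Function.comp_apply]
    rw [map_smul, ← smul_sub, norm_smul, norm_inv, Real.norm_of_nonneg (hS j).le,
      inv_mul_le_iff₀ (hS j), mul_comm (S j)]
    exact h3
  have h0 := c.eq_zero_of_bounded hr hyp (hXΛ 0) hI hcore hhX
    (fun n ↦ mem_closedBall_zero_iff.1 (hW1 n)) hhW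
  have h1 : (1 : ℝ) / 2 ≤ ‖W 0‖ := by
    refine ge_of_tendsto' (hW 0).norm fun j ↦ ?_
    rw [norm_smul, norm_inv, Real.norm_of_nonneg (hS j).le, le_inv_mul_iff₀ (hS j), zero_add]
    have := hm j
    linarith
  rw [h0, norm_zero] at h1
  norm_num at h1

end LowerBound

/-! ### Uniform estimates in charts -/

section Uniform

variable {E : Type*} [NormedAddCommGroup E] [NormedSpace ℝ E]
  {M : Type*} [MetricSpace M] [ChartedSpace E M]

/-- Stating smallness conditions as eventual ones allows several to be imposed on the same radius.
-/
theorem eventually_nhdsGT_of_exists {P : ℝ → Prop} (hP : ∀ ⦃ρ ρ' : ℝ⦄, ρ' ≤ ρ → P ρ → P ρ')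
    (h : ∃ ρ > 0, P ρ) : ∀ᶠ ρ in 𝓝[>] (0 : ℝ), P ρ := by
  obtain ⟨ρ, h0, h⟩ := h
  filter_upwards [Ioo_mem_nhdsGT h0] with ρ' h'
  exact hP h'.2.le h

/-- On the closed ball of radius `ρ` around the chart expression of `x`, the chart expression of
`k` is defined and `η`-close to its derivative at the center. -/
def ApproxAt (E : Type*) [NormedAddCommGroup E] [NormedSpace ℝ E] [ChartedSpace E M]
    (k : M → M) (η : ℝ) (a b x : M) (ρ : ℝ) : Prop :=
  ∀ u ∈ Metric.closedBall (extChartAt 𝓘(ℝ, E) a x) ρ, u ∈ locDom E k a b ∧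
    ‖fderiv ℝ (locMap E k a b) u - fderiv ℝ (locMap E k a b) (extChartAt 𝓘(ℝ, E) a x)‖ ≤ η ∧
    ∀ u' ∈ Metric.closedBall (extChartAt 𝓘(ℝ, E) a x) ρ,
      ‖locMap E k a b u - locMap E k a b u' -
        fderiv ℝ (locMap E k a b) (extChartAt 𝓘(ℝ, E) a x) (u - u')‖ ≤ η * ‖u - u'‖

theorem ApproxAt.anti {k : M → M} {η : ℝ} {a b x : M} {ρ ρ' : ℝ} (hρ : ρ' ≤ ρ)
    (h : ApproxAt E k η a b x ρ) : ApproxAt E k η a b x ρ' := fun u hu ↦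
  have h1 := h u (Metric.closedBall_subset_closedBall hρ hu)
  ⟨h1.1, h1.2.1, fun u' hu' ↦ h1.2.2 u' (Metric.closedBall_subset_closedBall hρ hu')⟩

theorem exists_approxAt [IsManifold 𝓘(ℝ, E) ∞ M] {k : M → M}
    (hk : ContMDiff 𝓘(ℝ, E) 𝓘(ℝ, E) 1 k) {η : ℝ} (hη : 0 < η) {a b : M} {K : Set M}
    (hK : IsCompact K) (hKa : K ⊆ (extChartAt 𝓘(ℝ, E) a).source)
    (hKb : MapsTo k K (extChartAt 𝓘(ℝ, E) b).source) :
    ∃ ρ > 0, ∀ x ∈ K, ApproxAt E k η a b x ρ := by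
  refine hK.induction_on (p := fun s ↦ ∃ ρ > 0, ∀ x ∈ s, ApproxAt E k η a b x ρ) ?_ ?_ ?_ ?_
  · exact ⟨1, one_pos, by simp⟩
  · rintro s s' hs ⟨ρ, h0, h⟩
    exact ⟨ρ, h0, fun x hx ↦ h x (hs hx)⟩
  · rintro s s' ⟨ρ, h0, h⟩ ⟨ρ', h0', h'⟩
    refine ⟨min ρ ρ', lt_min h0 h0', ?_⟩
    rintro x (hx | hx)
    · exact (h x hx).anti (min_le_left _ _)
    · exact (h' x hx).anti (min_le_right _ _)
  · intro x hx
    have hmem := mem_locDom (hKa hx) (hKb hx)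
    have hopen := isOpen_locDom (E := E) hk.continuous a b
    have hstr : HasStrictFDerivAt (locMap E k a b) (fderiv ℝ (locMap E k a b)
        (extChartAt 𝓘(ℝ, E) a x)) (extChartAt 𝓘(ℝ, E) a x) :=
      ((contDiffOn_locMap hk a b).contDiffAt (hopen.mem_nhds hmem)).hasStrictFDerivAt one_ne_zero
    -- Half of `η` goes to the linear approximation based at `x`; the other half pays for replacing
    -- the derivative at `x` by that at a nearby `y`.
    obtain ⟨s, hs, happ⟩ := hstr.approximates_deriv_on_nhds (c := ⟨η / 2, by positivity⟩)
      (Or.inr (by exact_mod_cast half_pos hη))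
    have hder := (continuousAt_fderiv_locMap hk hmem).preimage_mem_nhds
      (Metric.ball_mem_nhds _ (show 0 < η / 2 by positivity))
    obtain ⟨ρ, hρ, hball⟩ := Metric.mem_nhds_iff.1 (inter_mem (inter_mem hs hder)
      (hopen.mem_nhds hmem))
    refine ⟨(extChartAt 𝓘(ℝ, E) a) ⁻¹' Metric.ball (extChartAt 𝓘(ℝ, E) a x) (ρ / 4),
      mem_nhdsWithin_of_mem_nhds ((continuousAt_extChartAt' (hKa hx)).preimage_mem_nhds
        (Metric.ball_mem_nhds _ (by positivity))), ρ / 4, by positivity, ?_⟩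
    intro y hy
    have hy' : dist (extChartAt 𝓘(ℝ, E) a y) (extChartAt 𝓘(ℝ, E) a x) < ρ / 4 := hy
    have hsub : ∀ u ∈ Metric.closedBall (extChartAt 𝓘(ℝ, E) a y) (ρ / 4), u ∈ Metric.ball
        (extChartAt 𝓘(ℝ, E) a x) ρ := fun u hu ↦ by
      have h1 := dist_triangle u (extChartAt 𝓘(ℝ, E) a y) (extChartAt 𝓘(ℝ, E) a x)
      have h2 := Metric.mem_closedBall.1 hu
      rw [Metric.mem_ball]
      linarith
    have hy1 := hball (hsub (extChartAt 𝓘(ℝ, E) a y) (Metric.mem_closedBall_self (by positivity)))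
    have hd1 : ∀ u ∈ Metric.closedBall (extChartAt 𝓘(ℝ, E) a y) (ρ / 4),
        ‖fderiv ℝ (locMap E k a b) u -
          fderiv ℝ (locMap E k a b) (extChartAt 𝓘(ℝ, E) a x)‖ ≤ η / 2 := fun u hu ↦ by
      have h3 : _ < η / 2 := (hball (hsub u hu)).1.2
      rw [← dist_eq_norm]
      exact h3.le
    have hdy := hd1 (extChartAt 𝓘(ℝ, E) a y) (Metric.mem_closedBall_self (by positivity))
    intro u hu
    refine ⟨(hball (hsub u hu)).2, ?_, ?_⟩
    · have h4 := norm_sub_le_norm_sub_add_norm_sub (fderiv ℝ (locMap E k a b) u)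
        (fderiv ℝ (locMap E k a b) (extChartAt 𝓘(ℝ, E) a x))
        (fderiv ℝ (locMap E k a b) (extChartAt 𝓘(ℝ, E) a y))
      rw [norm_sub_rev (fderiv ℝ (locMap E k a b) (extChartAt 𝓘(ℝ, E) a x))] at h4
      have := hd1 u hu
      linarith
    · intro u' hu'
      have h5 : ‖locMap E k a b u - locMap E k a b u' -
          fderiv ℝ (locMap E k a b) (extChartAt 𝓘(ℝ, E) a x) (u - u')‖ ≤ η / 2 * ‖u - u'‖ :=
        happ u (hball (hsub u hu)).1.1 u' (hball (hsub u' hu')).1.1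
      have h6 := (fderiv ℝ (locMap E k a b) (extChartAt 𝓘(ℝ, E) a y) -
        fderiv ℝ (locMap E k a b) (extChartAt 𝓘(ℝ, E) a x)).le_of_opNorm_le hdy (u - u')
      have h7 : locMap E k a b u - locMap E k a b u' -
          fderiv ℝ (locMap E k a b) (extChartAt 𝓘(ℝ, E) a y) (u - u') =
        (locMap E k a b u - locMap E k a b u' -
          fderiv ℝ (locMap E k a b) (extChartAt 𝓘(ℝ, E) a x) (u - u')) -
        (fderiv ℝ (locMap E k a b) (extChartAt 𝓘(ℝ, E) a y) -
          fderiv ℝ (locMap E k a b) (extChartAt 𝓘(ℝ, E) a x)) (u - u') := by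
        rw [sub_apply]; abel
      rw [h7]
      refine (norm_sub_le _ _).trans ?_
      linarith

variable [RiemannianBundle (fun x : M ↦ TangentSpace 𝓘(ℝ, E) x)] [CompactSpace M]

theorem ChartCover.eventually_approxAt [IsManifold 𝓘(ℝ, E) ∞ M] (c : ChartCover E M) {k : M → M}
    (hk : ContMDiff 𝓘(ℝ, E) 𝓘(ℝ, E) 1 k) {η : ℝ} (hη : 0 < η) :
    ∀ᶠ ρ in 𝓝[>] (0 : ℝ), ∀ a ∈ c.centers, ∀ b ∈ c.centers, ∀ x ∈ c.core a, ∀ y ∈ c.core b,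
      dist (k x) y ≤ c.δ / 2 → ApproxAt E k η a b x ρ := by
  simp only [Finset.eventually_all]
  intro a ha b hb
  have hbc : IsCompact (c.core b) := (c.isClosed_core b).isCompact
  refine eventually_nhdsGT_of_exists
    (fun ρ ρ' hρ h x hx y hy hxy ↦ (h x hx y hy hxy).anti hρ) ?_
  -- The points of one core sent within `δ / 2` of the other form a compact set, and their images
  -- still lie in the second chart because `δ / 2 < δ`.
  obtain ⟨ρ, h0, h⟩ := exists_approxAt (E := E) hk hη (a := a) (b := b)
    (K := c.core a ∩ k ⁻¹' Metric.cthickening (c.δ / 2) (c.core b))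
    ((c.isClosed_core a).inter (Metric.isClosed_cthickening.preimage hk.continuous)).isCompact
    (fun x hx ↦ c.mem_source_self ha hx.1) (fun x hx ↦ by
      have h1 : k x ∈ Metric.cthickening (c.δ / 2) (c.core b) := hx.2
      rw [hbc.cthickening_eq_biUnion_closedBall (half_pos c.δ_pos).le] at h1
      simp only [mem_iUnion, Metric.mem_closedBall] at h1
      obtain ⟨y, hy, hxy⟩ := h1
      exact c.mem_source hb hy (hxy.trans_lt (half_lt_self c.δ_pos)))
  refine ⟨ρ, h0, fun x hx y hy hxy ↦ h x ⟨hx, ?_⟩⟩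
  exact Metric.mem_cthickening_of_dist_le _ y _ _ hy hxy

theorem ChartCover.eventually_dist_chart_le (c : ChartCover E M) {ρ : ℝ} (hρ : 0 < ρ) :
    ∀ᶠ τ in 𝓝[>] (0 : ℝ), ∀ a ∈ c.centers, ∀ x ∈ c.core a, ∀ y, dist y x ≤ τ →
      y ∈ (extChartAt 𝓘(ℝ, E) a).source ∧
      dist (extChartAt 𝓘(ℝ, E) a y) (extChartAt 𝓘(ℝ, E) a x) ≤ ρ := by
  simp only [Finset.eventually_all]
  intro a ha
  refine eventually_nhdsGT_of_exists (fun τ τ' hτ h x hx y hy ↦ h x hx y (hy.trans hτ)) ?_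
  have h1 := (c.isClosed_core a).isCompact.uniformContinuousAt_of_continuousAt
    (extChartAt 𝓘(ℝ, E) a) (fun x hx ↦ continuousAt_extChartAt' (c.mem_source_self ha hx))
    (Metric.dist_mem_uniformity hρ)
  obtain ⟨τ, h0, h2⟩ := Metric.mem_uniformity_dist.1 h1
  refine ⟨min (τ / 2) (c.δ / 2), lt_min (half_pos h0) (half_pos c.δ_pos), ?_⟩
  intro x hx y hy
  refine ⟨c.mem_source ha hx (lt_of_le_of_lt (hy.trans (min_le_right _ _))
    (half_lt_self c.δ_pos)), ?_⟩
  have h3 : dist x y < τ := by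
    rw [dist_comm]
    exact lt_of_le_of_lt (hy.trans (min_le_left _ _)) (half_lt_self h0)
  have h4 := h2 h3 hx
  rw [dist_comm]
  exact le_of_lt h4

theorem ChartCover.eventually_dist_symm_le (c : ChartCover E M) {τ : ℝ} (hτ : 0 < τ) :
    ∀ᶠ ρ in 𝓝[>] (0 : ℝ), ∀ a ∈ c.centers, ∀ x ∈ c.core a,
      ∀ u ∈ Metric.closedBall (extChartAt 𝓘(ℝ, E) a x) ρ,
        dist ((extChartAt 𝓘(ℝ, E) a).symm u) x ≤ τ := by
  simp only [Finset.eventually_all]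
  intro a ha
  refine eventually_nhdsGT_of_exists (fun ρ ρ' hρ h x hx u hu ↦ h x hx u
    (Metric.closedBall_subset_closedBall hρ hu)) ?_
  have hK : IsCompact (extChartAt 𝓘(ℝ, E) a '' c.core a) :=
    (c.isClosed_core a).isCompact.image_of_continuousOn
      ((continuousOn_extChartAt a).mono fun x hx ↦ c.mem_source_self ha hx)
  have h1 := hK.uniformContinuousAt_of_continuousAt (extChartAt 𝓘(ℝ, E) a).symm (by
    rintro _ ⟨x, hx, rfl⟩
    exact continuousAt_extChartAt_symm'' ((extChartAt 𝓘(ℝ, E) a).map_source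
      (c.mem_source_self ha hx))) (Metric.dist_mem_uniformity hτ)
  obtain ⟨ρ, h0, h2⟩ := Metric.mem_uniformity_dist.1 h1
  refine ⟨ρ / 2, half_pos h0, fun x hx u hu ↦ ?_⟩
  have h3 : dist (extChartAt 𝓘(ℝ, E) a x) u < ρ := by
    rw [dist_comm]
    exact lt_of_le_of_lt hu (half_lt_self h0)
  have h4 : dist ((extChartAt 𝓘(ℝ, E) a).symm (extChartAt 𝓘(ℝ, E) a x))
    ((extChartAt 𝓘(ℝ, E) a).symm u) < τ := h2 h3 (mem_image_of_mem _ hx)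
  rw [(extChartAt 𝓘(ℝ, E) a).left_inv (c.mem_source_self ha hx), dist_comm] at h4
  exact h4.le

end Uniform

/-- Iteration gives the bounds `S / 2 ^ j`. This is how the factor `1 / 2` of
`ChartCover.exists_lower_bound` is exploited. -/
theorem eq_zero_of_halving {E : Type*} [NormedAddCommGroup E] {w : ℤ → E} {S : ℝ}
    (hS : ∀ n, ‖w n‖ ≤ S)
    (h : ∀ S, (∀ n, ‖w n‖ ≤ S) → ∀ n, ‖w n‖ ≤ S / 2) (n : ℤ) : w n = 0 := by
  have h1 : ∀ j : ℕ, ∀ n, ‖w n‖ ≤ S * (1 / 2) ^ j := by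
    intro j
    induction j with
    | zero => simpa using hS
    | succ j ih =>
      intro n
      refine (h _ ih n).trans_eq ?_
      rw [pow_succ]; ring
  refine norm_le_zero_iff.1 (ge_of_tendsto' (x := atTop) ?_ fun j ↦ h1 j n)
  have := (tendsto_pow_atTop_nhds_zero_of_lt_one (r := (1 / 2 : ℝ)) (by norm_num)
    (by norm_num)).const_mul S
  simpa using this

theorem apply_emod_of_periodic {α : Type*} {f : ℤ → α} {N : ℕ} (hf : Function.Periodic f N)
    (n : ℤ) : f (n % N) = f n := by
  rw [Int.emod_def, mul_comm, ← smul_eq_mul]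
  exact hf.sub_zsmul_eq _

section Uniform

variable {M : Type*} [MetricSpace M] [CompactSpace M]

theorem eventually_dist_map_le {h : M → M} (hh : Continuous h) {ε : ℝ} (hε : 0 < ε) :
    ∀ᶠ τ in 𝓝[>] (0 : ℝ), ∀ x y, dist x y ≤ τ → dist (h x) (h y) < ε := by
  refine eventually_nhdsGT_of_exists (fun τ τ' hτ H x y hxy ↦ H x y (hxy.trans hτ)) ?_
  obtain ⟨τ, h0, H⟩ := Metric.uniformContinuous_iff.1
    (CompactSpace.uniformContinuous_of_continuous hh) ε hε
  exact ⟨τ / 2, half_pos h0, fun x y hxy ↦ H (lt_of_le_of_lt hxy (half_lt_self h0))⟩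

/-- Used to replace an orbit near `Λ` by points of `Λ`, which then form a pseudo-orbit. -/
theorem eventually_pseudoOrbit {h : M → M} (hh : Continuous h) {ε : ℝ} (hε : 0 < ε) :
    ∀ᶠ τ in 𝓝[>] (0 : ℝ), ∀ x y z z', dist x z ≤ τ → dist y z' ≤ τ → h x = y →
      dist (h z) z' < ε := by
  filter_upwards [eventually_dist_map_le hh (half_pos hε), Ioo_mem_nhdsGT (half_pos hε)] with
    τ h1 h2 x y z z' hx hy hxy
  have h3 := h1 _ _ hx
  have h4 := dist_triangle_left (h z) z' (h x)
  have h5 : dist (h x) z' < ε / 2 := hxy ▸ hy.trans_lt h2.2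
  linarith

end Uniform

/-! ### Expansivity and nondegeneracy of periodic orbits -/

section Hyperbolic

variable {E : Type*} [NormedAddCommGroup E] [NormedSpace ℝ E] [FiniteDimensional ℝ E]
  {M : Type*} [MetricSpace M] [ChartedSpace E M] [IsManifold 𝓘(ℝ, E) ∞ M]
  [RiemannianBundle (fun x : M ↦ TangentSpace 𝓘(ℝ, E) x)] [CompactSpace M]

/-- A diffeomorphism is expansive near a hyperbolic set. -/
theorem eventually_expansive (c : ChartCover E M)
    {r : WithTop ℕ∞} (hr : 1 ≤ r) {h : M ≃ₘ^r⟮𝓘(ℝ, E), 𝓘(ℝ, E)⟯ M}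
    {Λ : Set M} (hyp : IsHyperbolicSet h Λ) :
    ∀ᶠ τ in 𝓝[>] (0 : ℝ), ∀ x y : ℤ → M, (∀ n, h (x n) = x (n + 1)) →
      (∀ n, h (y n) = y (n + 1)) → (∀ n, ∃ z ∈ Λ, dist (x n) z ≤ τ) →
      (∀ n, dist (x n) (y n) ≤ τ) → ∀ n, x n = y n := by
  have hk : ContMDiff 𝓘(ℝ, E) 𝓘(ℝ, E) 1 h := h.contMDiff.of_le hr
  obtain ⟨κ, hκ, hlow⟩ := c.exists_lower_bound hr hyp
  obtain ⟨ρ, hρ, hρ0⟩ := ((c.eventually_approxAt hk hκ).and self_mem_nhdsWithin).exists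
  obtain ⟨τ, hτ, hτ0⟩ :=
    ((c.eventually_dist_chart_le (show 0 < ρ from hρ0)).and self_mem_nhdsWithin).exists
  replace hτ0 : 0 < τ := hτ0
  -- The tolerance is below `τ / 2` because `y n` is only within twice the tolerance of `z n`.
  filter_upwards [eventually_pseudoOrbit hk.continuous hκ,
    eventually_pseudoOrbit hk.continuous (half_pos c.δ_pos), Ioo_mem_nhdsGT (half_pos hτ0)]
    with δ h1 h2 h3 x y hx hy hxz hxy
  choose z hz hxz using hxz
  choose i hi hzi using fun n ↦ c.exists_ball (z n)
  have hX : ∀ n, x n ∈ (extChartAt 𝓘(ℝ, E) (i n)).source ∧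
      dist (extChartAt 𝓘(ℝ, E) (i n) (x n)) (extChartAt 𝓘(ℝ, E) (i n) (z n)) ≤ ρ := fun n ↦
    hτ _ (hi n) _ (hzi n) _ ((hxz n).trans (by linarith [h3.2]))
  have hY : ∀ n, y n ∈ (extChartAt 𝓘(ℝ, E) (i n)).source ∧
      dist (extChartAt 𝓘(ℝ, E) (i n) (y n)) (extChartAt 𝓘(ℝ, E) (i n) (z n)) ≤ ρ := fun n ↦
    hτ _ (hi n) _ (hzi n) _ (by
      have := dist_triangle_left (y n) (z n) (x n)
      linarith [h3.2, hxz n, hxy n])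
  have hstep : ∀ x : ℤ → M, (∀ n, h (x n) = x (n + 1)) →
      (∀ n, x n ∈ (extChartAt 𝓘(ℝ, E) (i n)).source) → ∀ n,
      locMap E h (i n) (i (n + 1)) (extChartAt 𝓘(ℝ, E) (i n) (x n)) =
        extChartAt 𝓘(ℝ, E) (i (n + 1)) (x (n + 1)) := fun x hx hs n ↦ by
    rw [locMap, (extChartAt 𝓘(ℝ, E) (i n)).left_inv (hs n), hx]
  -- The difference of the two orbits in charts follows the linear cocycle up to an error `κ` times
  -- its size, so any bound for it can be halved.
  have h0 := eq_zero_of_halving (S := ρ + ρ)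
    (w := fun n ↦ extChartAt 𝓘(ℝ, E) (i n) (x n) - extChartAt 𝓘(ℝ, E) (i n) (y n)) (fun n ↦ by
      have := dist_triangle_right (extChartAt 𝓘(ℝ, E) (i n) (x n))
        (extChartAt 𝓘(ℝ, E) (i n) (y n)) (extChartAt 𝓘(ℝ, E) (i n) (z n))
      rw [← dist_eq_norm]
      linarith [(hX n).2, (hY n).2]) (fun S hS ↦ by
    refine hlow z i _ S hz hi hzi (fun n ↦ h1 _ _ _ _ (hxz n) (hxz (n + 1)) (hx n)) hS fun n ↦ ?_
    have h4 := ((hρ _ (hi n) _ (hi (n + 1)) _ (hzi n) _ (hzi (n + 1))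
      (h2 _ _ _ _ (hxz n) (hxz (n + 1)) (hx n)).le) _ (hX n).2).2.2 _ (hY n).2
    rw [hstep x hx (fun n ↦ (hX n).1), hstep y hy (fun n ↦ (hY n).1)] at h4
    exact h4.trans (mul_le_mul_of_nonneg_left (hS n) hκ.le))
  intro n
  exact (extChartAt 𝓘(ℝ, E) (i n)).injOn (hX n).1 (hY n).1 (sub_eq_zero.1 (h0 n))

/-- A periodic orbit that stays near a hyperbolic set is nondegenerate. -/
theorem eventually_nondegenerate (c : ChartCover E M)
    {r : WithTop ℕ∞} (hr : 1 ≤ r) {h : M ≃ₘ^r⟮𝓘(ℝ, E), 𝓘(ℝ, E)⟯ M}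
    {Λ : Set M} (hyp : IsHyperbolicSet h Λ) :
    ∀ᶠ τ in 𝓝[>] (0 : ℝ), ∀ (q : M) (N : ℕ), N ≠ 0 →
      ((h.toEquiv : Equiv.Perm M) ^ N) q = q →
      (∀ n : ℤ, ∃ z ∈ Λ, dist (((h.toEquiv : Equiv.Perm M) ^ n) q) z ≤ τ) →
      ∀ v : E, tder ((h.toEquiv : Equiv.Perm M) ^ N) q v = v → v = 0 := by
  have hk : ContMDiff 𝓘(ℝ, E) 𝓘(ℝ, E) 1 h := h.contMDiff.of_le hr
  obtain ⟨κ, hκ, hlow⟩ := c.exists_lower_bound hr hyp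
  obtain ⟨ρ, hρ, hρ0⟩ := ((c.eventually_approxAt hk hκ).and self_mem_nhdsWithin).exists
  obtain ⟨τ, hτ, hτ0⟩ :=
    ((c.eventually_dist_chart_le (show 0 < ρ from hρ0)).and self_mem_nhdsWithin).exists
  replace hτ0 : 0 < τ := hτ0
  filter_upwards [eventually_pseudoOrbit hk.continuous hκ,
    eventually_pseudoOrbit hk.continuous (half_pos c.δ_pos), Ioo_mem_nhdsGT hτ0]
    with δ h1 h2 h3 q N hN hq hqz v hv
  set σ : Equiv.Perm M := h.toEquiv with hσ
  have hsucc : ∀ n : ℤ, ⇑(σ ^ (n + 1)) = h ∘ ⇑(σ ^ n) := fun n ↦ by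
    rw [add_comm, zpow_add, zpow_one]; rfl
  have hper : ∀ n : ℤ, ⇑(σ ^ (n + N)) = ⇑(σ ^ n) ∘ ⇑(σ ^ N) := fun n ↦ by
    rw [zpow_add, zpow_natCast]; rfl
  choose z hz hqz using hqz
  choose i hi hzi using fun n ↦ c.exists_ball (z n)
  have hYper : Function.Periodic (fun n : ℤ ↦ (σ ^ n) q) N := fun n ↦ by
    simp only [hper, Function.comp_apply, hq]
  have hvper : Function.Periodic (fun n : ℤ ↦ tder (σ ^ n) q v) N := fun n ↦ by
    simp only
    rw [hper, tder_comp (contMDiff_zpow hr h n) (by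
      simpa using contMDiff_zpow hr h (N : ℤ)), hq, ContinuousLinearMap.comp_apply, hv]
  have hmod : Function.Periodic (fun n : ℤ ↦ n % N) N := fun n ↦ by simp
  have hYm : ∀ n : ℤ, (σ ^ (n % N)) q = (σ ^ n) q := fun n ↦ by
    exact apply_emod_of_periodic hYper n
  have hX : ∀ n : ℤ, (σ ^ n) q ∈ (extChartAt 𝓘(ℝ, E) (i (n % N))).source ∧
      dist (extChartAt 𝓘(ℝ, E) (i (n % N)) ((σ ^ n) q))
        (extChartAt 𝓘(ℝ, E) (i (n % N)) (z (n % N))) ≤ ρ := fun n ↦ by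
    refine hτ _ (hi _) _ (hzi _) _ ?_
    rw [← hYm]
    exact (hqz _).trans h3.2.le
  -- Base points and chart indices are chosen modulo `N`, so the orbit of a fixed vector is periodic
  -- in charts and hence bounded.
  let w : ℤ → E := fun n ↦ chartDer (i (n % N)) ((σ ^ n) q) (tder (σ ^ n) q v)
  have hwper : Function.Periodic w N := fun n ↦ by
    have h4 := hYper n
    have h5 := hvper n
    have h6 := hmod n
    simp only at h4 h5 h6
    simp only [w, h4, h5, h6]
  have hw := eq_zero_of_halving (w := w) (S := ∑ m ∈ Finset.range N, ‖w m‖) (fun n ↦ by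
      have h4 : w (n % N) = w n := apply_emod_of_periodic hwper n
      have hN' : (0 : ℤ) < N := by exact_mod_cast Nat.pos_of_ne_zero hN
      have h5 := Int.emod_nonneg n hN'.ne'
      have h6 := Int.emod_lt_of_pos n hN'
      have h7 : ((n % N).toNat : ℤ) = n % N := Int.toNat_of_nonneg h5
      rw [← h4, ← h7]
      exact Finset.single_le_sum (f := fun m : ℕ ↦ ‖w m‖) (fun _ _ ↦ norm_nonneg _)
        (Finset.mem_range.2 (by omega))) (fun S hS ↦ by
    have hps : ∀ ε, (∀ x y z z', dist x z ≤ δ → dist y z' ≤ δ → h x = y → dist (h z) z' < ε) →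
        ∀ n : ℤ, dist (h (z (n % N))) (z ((n + 1) % N)) < ε := fun ε H n ↦ by
      refine H _ _ _ _ (hqz _) (hqz _) ?_
      rw [hYm, hYm, hsucc]; rfl
    refine hlow (fun n ↦ z (n % N)) (fun n ↦ i (n % N)) _ S (fun _ ↦ hz _) (fun _ ↦ hi _)
      (fun _ ↦ hzi _) (hps _ h1) hS fun n ↦ ?_
    have h4 := ((hρ _ (hi (n % N)) _ (hi ((n + 1) % N)) _ (hzi _) _ (hzi _)
      (hps _ h2 n).le) _ (hX n).2).2.1
    have hsrc : h ((σ ^ n) q) ∈ (extChartAt 𝓘(ℝ, E) (i ((n + 1) % N))).source := by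
      have := (hX (n + 1)).1
      rw [hsucc] at this
      exact this
    have h5 : w (n + 1) = fderiv ℝ (locMap E h (i (n % N)) (i ((n + 1) % N)))
        (extChartAt 𝓘(ℝ, E) (i (n % N)) ((σ ^ n) q)) (w n) := by
      simp only [w]
      rw [fderiv_locMap hk (hX n).1 hsrc, hsucc, tder_comp hk (contMDiff_zpow hr h n)]
      rfl
    rw [h5, ← sub_apply]
    exact (ContinuousLinearMap.le_of_opNorm_le _ h4 _).trans
      (mul_le_mul_of_nonneg_left (hS n) hκ.le)) 0
  have h8 : tder (⇑(σ ^ (0 : ℤ))) q v = v :=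
    congrArg (fun L : E →L[ℝ] E ↦ L v) (tder_id q)
  have h9 : w 0 = 0 := hw
  refine chartDer_injective (hX 0).1 ?_
  rw [map_zero, ← h9]
  simp only [w, h8]

end Hyperbolic

/-! ### The closing lemma -/

section Closing

variable {E : Type*} [NormedAddCommGroup E] [NormedSpace ℝ E] [FiniteDimensional ℝ E]

/-- Solvability of `u (j + 1) = F j (u j)` on `ZMod N`, for maps `F j` that are close to linear maps
`A j` such that the linear problem is uniformly nondegenerate. -/
theorem exists_periodic_solution {N : ℕ} [NeZero N] {F : ZMod N → E → E} {A : ZMod N → E →L[ℝ] E}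
    {u₀ : ZMod N → E} {κ ρ : ℝ} (hκ : 0 < κ) (hρ : 0 ≤ ρ)
    (hA : ∀ w : ZMod N → E, (∀ j, ‖w (j + 1) - A j (w j)‖ ≤ κ * ‖w‖) → w = 0)
    (hF : ∀ j, ∀ u ∈ Metric.closedBall (u₀ j) ρ, ∀ u' ∈ Metric.closedBall (u₀ j) ρ,
      ‖F j u - F j u' - A j (u - u')‖ ≤ κ / 2 * ‖u - u'‖)
    (h0 : ∀ j, ‖u₀ (j + 1) - F j (u₀ j)‖ ≤ κ / 2 * ρ) :
    ∃ u : ZMod N → E, (∀ j, u (j + 1) = F j (u j)) ∧ ∀ j, u j ∈ Metric.closedBall (u₀ j) ρ := by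
  let T : (ZMod N → E) →L[ℝ] (ZMod N → E) := ContinuousLinearMap.pi fun j ↦
    ContinuousLinearMap.proj (R := ℝ) (φ := fun _ : ZMod N ↦ E) (j + 1) -
      (A j).comp (ContinuousLinearMap.proj (R := ℝ) (φ := fun _ : ZMod N ↦ E) j)
  have hT : ∀ w j, T w j = w (j + 1) - A j (w j) := fun w j ↦ rfl
  have hlow : ∀ w, κ * ‖w‖ ≤ ‖T w‖ := by
    intro w
    by_contra! hlt
    have hw : w = 0 := hA w fun j ↦ by
      rw [← hT]
      exact (norm_le_pi_norm (T w) j).trans hlt.le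
    simp [hw] at hlt
  -- Sequences indexed by `ZMod N` form a finite-dimensional space, so the lower bound for `T` makes
  -- it invertible, with inverse of norm at most `κ⁻¹`.
  have hinj : Function.Injective (T : (ZMod N → E) →ₗ[ℝ] (ZMod N → E)) := by
    rw [injective_iff_map_eq_zero]
    intro w hw
    have h1 := hlow w
    have h2 : T w = 0 := hw
    rw [h2, norm_zero] at h1
    exact norm_le_zero_iff.1 (nonpos_of_mul_nonpos_right h1 hκ)
  let e := LinearEquiv.ofInjectiveEndo (T : (ZMod N → E) →ₗ[ℝ] (ZMod N → E)) hinj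
  have he : ∀ y, T (e.symm y) = y := fun y ↦ e.apply_symm_apply y
  let R : T.NonlinearRightInverse :=
    { toFun := e.symm
      nnnorm := ⟨κ⁻¹, by positivity⟩
      bound' := fun y ↦ by
        have h1 := hlow (e.symm y)
        rw [he] at h1
        exact (le_inv_mul_iff₀ hκ).2 h1
      right_inv' := he }
  let G : (ZMod N → E) → ZMod N → E := fun u j ↦ u (j + 1) - F j (u j)
  obtain ⟨κ', hκ'⟩ : ∃ κ' : NNReal, (κ' : ℝ) = κ / 2 := ⟨⟨κ / 2, by positivity⟩, rfl⟩
  have hR : (R.nnnorm : ℝ) = κ⁻¹ := rfl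
  have happ : ApproximatesLinearOn G T (Metric.closedBall u₀ ρ) κ' := by
    intro u hu u' hu'
    rw [hκ', pi_norm_le_iff_of_nonneg (by positivity)]
    intro j
    have h1 := hF j (u j) (Metric.mem_closedBall.2 ((dist_le_pi_dist u u₀ j).trans hu)) (u' j)
      (Metric.mem_closedBall.2 ((dist_le_pi_dist u' u₀ j).trans hu'))
    have h2 : (G u - G u' - T (u - u')) j = -(F j (u j) - F j (u' j) - A j (u j - u' j)) := by
      simp only [Pi.sub_apply, hT, G]
      abel
    rw [h2, norm_neg]
    refine h1.trans (mul_le_mul_of_nonneg_left ?_ (by positivity))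
    exact norm_le_pi_norm (u - u') j
  -- `G` is `κ / 2`-close to `T`, so the image of the `ρ`-ball contains a ball of radius `(κ - κ /
  -- 2) * ρ` about `G u₀`, and hence zero.
  have hsurj := happ.surjOn_closedBall_of_nonlinearRightInverse R hρ Subset.rfl
  obtain ⟨u, hu, hGu⟩ := @hsurj 0 (by
    have h1 : (κ⁻¹⁻¹ - κ / 2) * ρ = κ / 2 * ρ := by
      rw [inv_inv]; ring
    rw [hR, hκ', h1, Metric.mem_closedBall, dist_zero_left, pi_norm_le_iff_of_nonneg (by positivity)]
    exact h0)
  refine ⟨u, fun j ↦ sub_eq_zero.1 (congrFun hGu j), fun j ↦ ?_⟩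
  exact Metric.mem_closedBall.2 ((dist_le_pi_dist u u₀ j).trans hu)

variable {M : Type*} [MetricSpace M] [ChartedSpace E M] [IsManifold 𝓘(ℝ, E) ∞ M]
  [RiemannianBundle (fun x : M ↦ TangentSpace 𝓘(ℝ, E) x)] [CompactSpace M]

/-- The closing lemma: periodic pseudo-orbits in a hyperbolic set are shadowed by periodic orbits. -/
theorem exists_closing (c : ChartCover E M)
    {r : WithTop ℕ∞} (hr : 1 ≤ r) {h : M ≃ₘ^r⟮𝓘(ℝ, E), 𝓘(ℝ, E)⟯ M}
    {Λ : Set M} (hyp : IsHyperbolicSet h Λ) {τ : ℝ} (hτ : 0 < τ) :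
    ∃ ε > 0, ∀ (N : ℕ) [NeZero N] (x : ZMod N → M), (∀ j, x j ∈ Λ) →
      (∀ j, dist (h (x j)) (x (j + 1)) < ε) →
      ∃ y : ZMod N → M, (∀ j, h (y j) = y (j + 1)) ∧ ∀ j, dist (y j) (x j) ≤ τ := by
  have hk : ContMDiff 𝓘(ℝ, E) 𝓘(ℝ, E) 1 h := h.contMDiff.of_le hr
  obtain ⟨κ, hκ, hlow⟩ := c.exists_lower_bound hr hyp
  obtain ⟨ρ, ⟨hρ, hsymm⟩, hρ0⟩ := (((c.eventually_approxAt hk (half_pos hκ)).and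
    (c.eventually_dist_symm_le hτ)).and self_mem_nhdsWithin).exists
  replace hρ0 : 0 < ρ := hρ0
  obtain ⟨ε, hε, hε0⟩ := ((c.eventually_dist_chart_le (show 0 < κ / 2 * ρ by positivity)).and
    self_mem_nhdsWithin).exists
  replace hε0 : 0 < ε := hε0
  refine ⟨min (min κ (c.δ / 2)) ε, lt_min (lt_min hκ (half_pos c.δ_pos)) hε0, ?_⟩
  intro N _ x hx hd
  choose i hi hxi using fun j ↦ c.exists_ball (x j)
  have hd1 : ∀ j, dist (h (x j)) (x (j + 1)) < κ := fun j ↦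
    (hd j).trans_le ((min_le_left _ _).trans (min_le_left _ _))
  have hd2 : ∀ j, dist (h (x j)) (x (j + 1)) ≤ c.δ / 2 := fun j ↦
    ((hd j).trans_le ((min_le_left _ _).trans (min_le_right _ _))).le
  have hd3 : ∀ j, dist (h (x j)) (x (j + 1)) ≤ ε := fun j ↦
    ((hd j).trans_le (min_le_right _ _)).le
  have happ := fun j ↦ hρ _ (hi j) _ (hi (j + 1)) _ (hxi j) _ (hxi (j + 1)) (hd2 j)
  obtain ⟨u, hu, hub⟩ := exists_periodic_solution (N := N)
    (F := fun j ↦ locMap E h (i j) (i (j + 1)))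
    (A := fun j ↦ fderiv ℝ (locMap E h (i j) (i (j + 1))) (extChartAt 𝓘(ℝ, E) (i j) (x j)))
    (u₀ := fun j ↦ extChartAt 𝓘(ℝ, E) (i j) (x j)) hκ hρ0.le (fun w hw ↦ by
      have h1 : ∀ n : ℤ, ((n + 1 : ℤ) : ZMod N) = (n : ZMod N) + 1 := fun n ↦ by push_cast; rfl
      -- Unrolled to a periodic sequence over `ℤ`, `w` satisfies the lower bound with `S = ‖w‖`,
      -- which forces `‖w‖ ≤ ‖w‖ / 2`.
      have h2 := hlow (fun n ↦ x n) (fun n ↦ i n) (fun n ↦ w n) ‖w‖ (fun _ ↦ hx _) (fun _ ↦ hi _)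
        (fun _ ↦ hxi _) (fun n ↦ by rw [h1]; exact hd1 _) (fun _ ↦ norm_le_pi_norm w _)
        (fun n ↦ by simp only [h1]; exact hw _)
      have h3 : ‖w‖ ≤ ‖w‖ / 2 := by
        rw [pi_norm_le_iff_of_nonneg (by positivity)]
        intro j
        have := h2 (j.val : ℤ)
        simpa using this
      exact norm_le_zero_iff.1 (by linarith))
    (fun j u hu u' hu' ↦ ((happ j) u hu).2.2 u' hu')
    (fun j ↦ by
      have h1 := (hε _ (hi (j + 1)) _ (hxi (j + 1)) _ (hd3 j)).2
      rw [locMap, (extChartAt 𝓘(ℝ, E) (i j)).left_inv (c.mem_source_self (hi j) (hxi j)),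
        ← dist_eq_norm, dist_comm]
      exact h1)
  refine ⟨fun j ↦ (extChartAt 𝓘(ℝ, E) (i j)).symm (u j), fun j ↦ ?_,
    fun j ↦ hsymm _ (hi j) _ (hxi j) _ (hub j)⟩
  have h1 := ((happ j) _ (hub j)).1.2
  simp only
  rw [hu j, locMap, (extChartAt 𝓘(ℝ, E) (i (j + 1))).left_inv h1]

end Closing

/-! ### Nondegenerate fixed points and commuting maps -/

section Commuting

variable {E : Type*} [NormedAddCommGroup E] [NormedSpace ℝ E]

/-- Determinants are multiplicative and the left inverse `Q` forces `det P ≠ 0`. It gives both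
independence of the chart and constancy along orbits of a commuting map. -/
theorem det_one_sub_eq_of_conj {A B P Q : E →L[ℝ] E} (hQP : Q.comp P = ContinuousLinearMap.id ℝ E)
    (h : A.comp P = P.comp B) : (1 - A).det = (1 - B).det := by
  have h1 : (1 - A).comp P = P.comp (1 - B) := by
    ext v
    have := congrArg (fun L : E →L[ℝ] E ↦ L v) h
    simp only [ContinuousLinearMap.comp_apply] at this
    simp [this]
  have h2 : (Q.det) * P.det = 1 := by
    have := congrArg ContinuousLinearMap.det hQP
    simp only [ContinuousLinearMap.det] at this ⊢
    rw [← LinearMap.det_comp]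
    exact this.trans LinearMap.det_id
  have h3 := congrArg ContinuousLinearMap.det h1
  have h4 : (1 - A).det * P.det = P.det * (1 - B).det := by
    simp only [ContinuousLinearMap.det] at h3 ⊢
    rw [← LinearMap.det_comp, ← LinearMap.det_comp]
    exact h3
  rw [mul_comm] at h4
  exact mul_left_cancel₀ (right_ne_zero_of_mul_eq_one h2) h4

variable
  {M : Type*} [MetricSpace M] [ChartedSpace E M] [IsManifold 𝓘(ℝ, E) ∞ M]

theorem det_fderiv_locMap_of_fixed {k : M → M} (hk : ContMDiff 𝓘(ℝ, E) 𝓘(ℝ, E) 1 k) {a y : M}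
    (hy : y ∈ (extChartAt 𝓘(ℝ, E) a).source) (hky : k y = y) :
    (1 - fderiv ℝ (locMap E k a a) (extChartAt 𝓘(ℝ, E) a y)).det = (1 - tder (E := E) k y).det := by
  obtain ⟨e, he⟩ : (chartDer (E := E) a y).IsInvertible :=
    isInvertible_mfderiv_extChartAt (I := 𝓘(ℝ, E)) hy
  refine det_one_sub_eq_of_conj (P := e) (Q := e.symm) (by ext v; simp) ?_
  ext v
  have h1 := fderiv_locMap hk hy (b := a) (by rwa [hky]) v
  rw [hky, ← he] at h1
  exact h1

variable [FiniteDimensional ℝ E]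

/-- The fixed points of `k` at which `det (1 - Dk)` takes a given nonzero value are finitely
many. -/
theorem finite_fixed_of_det [CompactSpace M] {k : M → M} (hk : ContMDiff 𝓘(ℝ, E) 𝓘(ℝ, E) 1 k) {d : ℝ}
    (hd : d ≠ 0) : {y : M | k y = y ∧ (1 - tder (E := E) k y).det = d}.Finite := by
  by_contra hinf
  obtain ⟨a, -, ha⟩ := Set.Infinite.exists_accPt_of_subset_isCompact hinf isCompact_univ
    (subset_univ _)
  have hka : k a = a := by
    have hcl : IsClosed {y | k y = y} := isClosed_eq hk.continuous continuous_id
    exact hcl.closure_subset_iff.2 (fun y (hy : k y = y ∧ _) ↦ hy.1)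
      (mem_closure_iff_clusterPt.2 ha.clusterPt)
  have hasrc := mem_extChartAt_source (I := 𝓘(ℝ, E)) a
  have hmem := mem_locDom (E := E) hasrc (b := a) (by rwa [hka] : k a ∈ _)
  have hne : (𝓝[≠] a ⊓ 𝓟 {y : M | k y = y ∧ (1 - tder (E := E) k y).det = d}).NeBot := ha
  have hle : 𝓝[≠] a ⊓ 𝓟 {y : M | k y = y ∧ (1 - tder (E := E) k y).det = d} ≤ 𝓝 a :=
    inf_le_left.trans nhdsWithin_le_nhds
  have hfix : ∀ᶠ y in 𝓝[≠] a ⊓ 𝓟 {y : M | k y = y ∧ (1 - tder (E := E) k y).det = d},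
      k y = y ∧ (1 - tder (E := E) k y).det = d := mem_inf_of_right (mem_principal_self _)
  have hsrc : ∀ᶠ y in 𝓝 a, y ∈ (extChartAt 𝓘(ℝ, E) a).source := extChartAt_source_mem_nhds a
  have hcont : ContinuousAt (fun y ↦ (1 - fderiv ℝ (locMap E k a a)
      (extChartAt 𝓘(ℝ, E) a y)).det) a := by
    have h1 : ContinuousAt (fun y ↦ fderiv ℝ (locMap E k a a) (extChartAt 𝓘(ℝ, E) a y)) a :=
      ContinuousAt.comp (f := extChartAt 𝓘(ℝ, E) a) (continuousAt_fderiv_locMap hk hmem)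
        (continuousAt_extChartAt a)
    exact ContinuousLinearMap.continuous_det.continuousAt.comp (continuousAt_const.sub h1)
  have hdet : (1 - fderiv ℝ (locMap E k a a) (extChartAt 𝓘(ℝ, E) a a)).det = d := by
    refine tendsto_nhds_unique (hcont.tendsto.mono_left hle) ?_
    refine tendsto_const_nhds.congr' ?_
    filter_upwards [hfix, hle hsrc] with y hy hys
    rw [det_fderiv_locMap_of_fixed hk hys hy.1, hy.2]
  -- The accumulation point `a` is itself fixed, with the same determinant `d ≠ 0` by continuity. So
  -- `u - k u` has invertible derivative there, and `a` is an isolated fixed point.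
  have hdiff : HasFDerivAt (fun u ↦ u - locMap E k a a u)
      (1 - fderiv ℝ (locMap E k a a) (extChartAt 𝓘(ℝ, E) a a)) (extChartAt 𝓘(ℝ, E) a a) :=
    (hasFDerivAt_id _).sub (((contDiffOn_locMap hk a a).contDiffAt
      ((isOpen_locDom hk.continuous a a).mem_nhds hmem)).differentiableAt one_ne_zero).hasFDerivAt
  let e := ContinuousLinearMap.toContinuousLinearEquivOfDetNeZero
    (1 - fderiv ℝ (locMap E k a a) (extChartAt 𝓘(ℝ, E) a a)) (by rw [hdet]; exact hd)
  have hev := hdiff.eventually_ne (c := 0) ⟨_, e.antilipschitz⟩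
  rw [eventually_nhdsWithin_iff] at hev
  have hev' := (continuousAt_extChartAt (I := 𝓘(ℝ, E)) a).eventually hev
  have hne' : ∀ᶠ y in 𝓝[≠] a ⊓ 𝓟 {y : M | k y = y ∧ (1 - tder (E := E) k y).det = d}, y ≠ a :=
    mem_inf_of_left self_mem_nhdsWithin
  obtain ⟨y, ⟨⟨⟨hy, hys⟩, hya⟩, hyev⟩⟩ := (((hfix.and (hle hsrc)).and hne').and (hle hev')).exists
  refine hyev (fun h ↦ hya ((extChartAt 𝓘(ℝ, E) a).injOn hys hasrc h)) ?_
  rw [locMap, (extChartAt 𝓘(ℝ, E) a).left_inv hys, hy.1, sub_self]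

/-- A nondegenerate fixed point of `k` is periodic for every diffeomorphism commuting with `k`. -/
theorem exists_iterate_eq_of_commute [CompactSpace M] {k f f' : M → M}
    (hk : ContMDiff 𝓘(ℝ, E) 𝓘(ℝ, E) 1 k)
    (hf : ContMDiff 𝓘(ℝ, E) 𝓘(ℝ, E) 1 f) (hf' : ContMDiff 𝓘(ℝ, E) 𝓘(ℝ, E) 1 f')
    (hff' : ∀ x, f' (f x) = x) (hkf : ∀ x, k (f x) = f (k x)) {q : M} (hq : k q = q)
    (hnd : ∀ v : E, tder k q v = v → v = 0) : ∃ m ≠ 0, f^[m] q = q := by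
  have hd : (1 - tder (E := E) k q).det ≠ 0 := by
    intro h0
    obtain ⟨v, hv, hv0⟩ := Submodule.exists_mem_ne_zero_of_ne_bot
      (LinearMap.bot_lt_ker_of_det_eq_zero h0).ne'
    refine hv0 (hnd v ?_)
    have : v - tder k q v = 0 := hv
    exact (sub_eq_zero.1 this).symm
  -- `Df` conjugates `Dk` at a fixed point to `Dk` at its image.
  have hmem : ∀ n : ℕ, f^[n] q ∈ {y : M | k y = y ∧
      (1 - tder (E := E) k y).det = (1 - tder (E := E) k q).det} := by
    intro n
    induction n with
    | zero => exact ⟨hq, rfl⟩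
    | succ n ih =>
      rw [Function.iterate_succ_apply']
      refine ⟨by rw [hkf, ih.1], ?_⟩
      rw [← ih.2]
      refine det_one_sub_eq_of_conj (P := tder f (f^[n] q)) (Q := tder f' (f (f^[n] q))) ?_ ?_
      · rw [← tder_comp hf' hf, ← tder_id (f^[n] q)]
        exact congrArg (fun l : M → M ↦ tder l (f^[n] q)) (funext hff')
      · have h1 := tder_comp (E := E) hk hf (f^[n] q)
        have h2 := tder_comp (E := E) hf hk (f^[n] q)
        rw [ih.1] at h2
        rw [← h1, ← h2]
        exact congrArg (fun l : M → M ↦ tder l (f^[n] q)) (funext hkf)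
  have hinj : ¬ Function.Injective fun n : ℕ ↦ f^[n] q := fun hi ↦
    Set.infinite_of_injective_forall_mem hi hmem (finite_fixed_of_det hk hd)
  have hfinj : Function.Injective f := Function.LeftInverse.injective hff'
  simp only [Function.Injective, not_forall] at hinj
  obtain ⟨m, n, hmn, hne⟩ := hinj
  have key : ∀ m n : ℕ, m < n → f^[m] q = f^[n] q → ∃ m ≠ 0, f^[m] q = q := fun m n hlt h ↦ by
    refine ⟨n - m, by omega, hfinj.iterate m ?_⟩
    rw [← Function.iterate_add_apply, h]
    congr 2
    omega
  rcases lt_or_gt_of_ne hne with hlt | hlt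
  · exact key m n hlt hmn
  · exact key n m hlt hmn.symm

end Commuting

/-! ### Orbits of permutations -/

section Perm

variable {M : Type*}

/-- The periodic points of `σ`. -/
def perSet (σ : Equiv.Perm M) : Set M := {p | ∃ N ≠ 0, (σ ^ N) p = p}

theorem zpow_add_one_apply (σ : Equiv.Perm M) (n : ℤ) (x : M) : (σ ^ (n + 1)) x = σ ((σ ^ n) x) := by
  rw [add_comm, zpow_add, zpow_one]; rfl

theorem zpow_orbit (σ : Equiv.Perm M) (x : M) (n : ℤ) : σ ((σ ^ n) x) = (σ ^ (n + 1)) x :=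
  (zpow_add_one_apply σ n x).symm

theorem zpow_add_apply (σ : Equiv.Perm M) (m n : ℤ) (x : M) :
    (σ ^ (m + n)) x = (σ ^ m) ((σ ^ n) x) := by
  rw [zpow_add]; rfl

theorem zpow_mul_apply_of_mem_perSet {σ : Equiv.Perm M} {x : M} {N : ℕ} (h : (σ ^ N) x = x)
    (k : ℤ) : (σ ^ ((N : ℤ) * k)) x = x := by
  have h1 : Function.IsFixedPt ⇑(σ ^ (N : ℤ)) x := by rw [zpow_natCast]; exact h
  rw [zpow_mul]
  exact h1.perm_zpow k

theorem eq_zpow_of_orbit {σ : Equiv.Perm M} {y : ℤ → M} (hy : ∀ n, σ (y n) = y (n + 1)) (n : ℤ) :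
    (σ ^ n) (y 0) = y n := by
  induction n with
  | zero => rfl
  | succ n ih => rw [zpow_add_one_apply, ih, hy]
  | pred n ih =>
    have h1 := zpow_add_one_apply σ (-(n : ℤ) - 1) (y 0)
    rw [sub_add_cancel, ih] at h1
    have h2 := hy (-(n : ℤ) - 1)
    rw [sub_add_cancel] at h2
    exact σ.injective (h1.symm.trans h2.symm)

theorem zpow_mem {σ : Equiv.Perm M} {Λ : Set M} (hΛ : σ '' Λ = Λ) {x : M} (hx : x ∈ Λ) (n : ℤ) :
    (σ ^ n) x ∈ Λ := by
  have h1 : ∀ y, σ y ∈ Λ → y ∈ Λ := fun y hy ↦ by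
    rw [← hΛ] at hy
    exact (σ.injective.mem_set_image).1 hy
  induction n with
  | zero => exact hx
  | succ n ih =>
    rw [zpow_add_one_apply, ← hΛ]
    exact mem_image_of_mem _ ih
  | pred n ih =>
    refine h1 _ ?_
    rw [← zpow_add_one_apply, sub_add_cancel]
    exact ih

theorem exists_seq_of_transGen {α : Type*} {r : α → α → Prop} {a b : α}
    (h : Relation.TransGen r a b) :
    ∃ (n : ℕ) (c : ℕ → α), 1 ≤ n ∧ c 0 = a ∧ c n = b ∧ ∀ j < n, r (c j) (c (j + 1)) := by
  induction h with
  | single hab =>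
    rename_i b
    refine ⟨1, fun j ↦ if j = 0 then a else b, le_rfl, by simp, by simp, fun j hj ↦ ?_⟩
    obtain rfl : j = 0 := by omega
    simpa using hab
  | tail _ hbc ih =>
    rename_i b d _
    obtain ⟨n, c, hn, h0, hb, hc⟩ := ih
    refine ⟨n + 1, fun j ↦ if j ≤ n then c j else d, by omega, by simpa using h0, by simp,
      fun j hj ↦ ?_⟩
    rcases Nat.lt_or_ge j n with hjn | hjn
    · have h1 : j ≤ n := hjn.le
      have h2 : j + 1 ≤ n := hjn
      simpa [h1, h2] using hc j hjn
    · obtain rfl : j = n := by omega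
      simpa [hb] using hbc

end Perm

/-! ### Pseudo-orbits and shadowing -/

section Dynamics

variable {M : Type*} [MetricSpace M]

/-- One step of an `ε`-pseudo-orbit inside `Λ`. -/
def Step (σ : Equiv.Perm M) (Λ : Set M) (ε : ℝ) (x y : M) : Prop :=
  x ∈ Λ ∧ y ∈ Λ ∧ dist (σ x) y < ε

/-- Two orbits that stay close to each other and to `Λ` coincide. -/
def ExpansiveNear (σ : Equiv.Perm M) (Λ : Set M) (τ : ℝ) : Prop :=
  ∀ x y : ℤ → M, (∀ n, σ (x n) = x (n + 1)) → (∀ n, σ (y n) = y (n + 1)) →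
    (∀ n, ∃ z ∈ Λ, dist (x n) z ≤ τ) → (∀ n, dist (x n) (y n) ≤ τ) → ∀ n, x n = y n

/-- Periodic pseudo-orbits in `Λ` are shadowed by periodic orbits. -/
def HasClosing (σ : Equiv.Perm M) (Λ : Set M) : Prop :=
  ∀ τ > 0, ∃ ε > 0, ∀ (N : ℕ) [NeZero N] (x : ZMod N → M), (∀ j, x j ∈ Λ) →
    (∀ j, dist (σ (x j)) (x (j + 1)) < ε) →
    ∃ y : ZMod N → M, (∀ j, σ (y j) = y (j + 1)) ∧ ∀ j, dist (y j) (x j) ≤ τ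

/-- Steps of pseudo-orbits in `Λ` can be reversed by pseudo-orbits in `Λ`. -/
def Reversible (σ : Equiv.Perm M) (Λ : Set M) : Prop :=
  ∀ ε > 0, ∃ ε' > 0, ∀ x y, Step σ Λ ε' x y → Relation.TransGen (Step σ Λ ε) y x

/-- The points whose `σ`-orbit stays `τ`-close to `Λ`. -/
def nearSet (σ : Equiv.Perm M) (Λ : Set M) (τ : ℝ) : Set M :=
  {x | ∀ n : ℤ, ∃ z ∈ Λ, dist ((σ ^ n) x) z ≤ τ}

theorem Step.mono {σ : Equiv.Perm M} {Λ : Set M} {ε ε' : ℝ} (h : ε ≤ ε') {x y : M}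
    (hxy : Step σ Λ ε x y) : Step σ Λ ε' x y :=
  ⟨hxy.1, hxy.2.1, hxy.2.2.trans_le h⟩

theorem continuous_zpow {σ : Equiv.Perm M} (h : Continuous σ) (h' : Continuous σ.symm) (n : ℤ) :
    Continuous ⇑(σ ^ n) := by
  induction n with
  | zero => exact continuous_id
  | succ n ih =>
    rw [zpow_add_one]
    exact ih.comp h
  | pred n ih =>
    rw [zpow_sub_one]
    exact ih.comp h'

/-- A chain that jumps to an orbit, follows it, and jumps off it. -/
theorem hasChain_of_orbit {σ : Equiv.Perm M} {ε : ℝ} (hε : 0 < ε) {w : ℤ → M}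
    (hw : ∀ n, σ (w n) = w (n + 1)) {a b : ℤ} (hab : a < b) {p q : M}
    (hp : dist (σ p) (w a) < ε) (hq : dist (w b) q < ε) : HasChain σ ε p q := by
  obtain ⟨m, hm⟩ : ∃ m : ℕ, b = a + (m + 1) := ⟨(b - a - 1).toNat, by omega⟩
  -- The chain is `p, w a, …, w (b - 1), q`; the last jump puts `q` in place of `w b`.
  refine ⟨m + 2, fun j ↦ if j = 0 then p else if j = m + 2 then q else w (a + j - 1), by omega,
    by simp, by simp, fun j h1 h2 ↦ ?_⟩
  rcases Nat.lt_or_ge 1 j with hj | hj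
  · have h3 : j - 1 ≠ 0 := by omega
    have h4 : j - 1 ≠ m + 2 := by omega
    have h5 : j ≠ 0 := by omega
    have h6 : σ (w (a + ((j - 1 : ℕ) : ℤ) - 1)) = w (a + j - 1) := by
      rw [hw]; congr 1; omega
    simp only [h3, h4, h5, if_false]
    rw [h6]
    split_ifs with h7
    · have h8 : a + (j : ℤ) - 1 = b := by omega
      rw [h8]; exact hq
    · simpa using hε
  · obtain rfl : j = 1 := by omega
    have h7 : (1 : ℕ) ≠ m + 2 := by omega
    have h8 : a + ((1 : ℕ) : ℤ) - 1 = a := by omega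
    simp only [Nat.sub_self, if_true, one_ne_zero, if_false, h7, h8]
    exact hp

theorem reflTransGen_orbit {σ : Equiv.Perm M} {Λ : Set M} (hΛ : σ '' Λ = Λ) {ε : ℝ} (hε : 0 < ε)
    {x : M} (hx : x ∈ Λ) (m : ℕ) (n : ℕ) :
    Relation.ReflTransGen (Step σ Λ ε) ((σ ^ (m : ℤ)) x) ((σ ^ ((m + n : ℕ) : ℤ)) x) := by
  induction n with
  | zero => exact Relation.ReflTransGen.refl
  | succ n ih =>
    refine ih.tail ⟨zpow_mem hΛ hx _, zpow_mem hΛ hx _, ?_⟩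
    rw [← zpow_add_one_apply]
    have : ((m + n : ℕ) : ℤ) + 1 = ((m + (n + 1) : ℕ) : ℤ) := by omega
    rw [this, dist_self]
    exact hε

/-- Jump from `x` to a point of `Λ` near `σ x` that some positive iterate brings near `y`, and
follow its orbit. -/
theorem transGen_of_mixing {σ : Equiv.Perm M} {Λ : Set M} (hΛ : σ '' Λ = Λ)
    (hmix : IsMixingOn σ Λ) {ε : ℝ} (hε : 0 < ε) {x y : M} (hx : x ∈ Λ) (hy : y ∈ Λ) :
    Relation.TransGen (Step σ Λ ε) x y := by
  have hσx : σ x ∈ Λ := by rw [← hΛ]; exact mem_image_of_mem _ hx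
  obtain ⟨N, hN⟩ := hmix (Metric.ball (σ x) ε) (Metric.ball y ε) Metric.isOpen_ball
    Metric.isOpen_ball ⟨σ x, Metric.mem_ball_self hε, hσx⟩ ⟨y, Metric.mem_ball_self hε, hy⟩
  obtain ⟨_, ⟨u, ⟨hu, huΛ⟩, rfl⟩, hv, -⟩ := hN (N + 1) (by omega)
  have h1 : Step σ Λ ε x u := ⟨hx, huΛ, by rw [dist_comm]; exact hu⟩
  have h2 := reflTransGen_orbit hΛ hε huΛ 0 N
  have h3 : Step σ Λ ε ((σ ^ ((0 + N : ℕ) : ℤ)) u) y := by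
    refine ⟨zpow_mem hΛ huΛ _, hy, ?_⟩
    rw [← zpow_add_one_apply]
    have h4 : ((0 + N : ℕ) : ℤ) + 1 = ((N + 1 : ℕ) : ℤ) := by omega
    rw [h4, zpow_natCast, ← Equiv.Perm.iterate_eq_pow]
    exact hv
  exact (Relation.TransGen.trans_left (Relation.TransGen.single h1) h2).tail h3

theorem transGen_of_reversible {σ : Equiv.Perm M} {Λ : Set M} {ε ε' : ℝ}
    (h : ∀ x y, Step σ Λ ε' x y → Relation.TransGen (Step σ Λ ε) y x) {x : ℤ → M}
    (hx : ∀ n, Step σ Λ ε' (x n) (x (n + 1))) (a : ℤ) (n : ℕ) :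
    Relation.TransGen (Step σ Λ ε) (x (a + n + 1)) (x a) := by
  induction n with
  | zero => simpa using h _ _ (hx a)
  | succ n ih =>
    refine Relation.TransGen.trans ?_ ih
    have h1 := h _ _ (hx (a + n + 1))
    push_cast
    rw [← add_assoc]
    exact h1

/-- Since `Λ` is compact, being within `τ` of some point of it means lying in the closed thickening.
-/
theorem isClosed_nearSet {σ : Equiv.Perm M} {Λ : Set M} (h : Continuous σ) (h' : Continuous σ.symm)
    (hΛ : IsCompact Λ) {τ : ℝ} (hτ : 0 ≤ τ) : IsClosed (nearSet σ Λ τ) := by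
  have h1 : nearSet σ Λ τ = ⋂ n : ℤ, ⇑(σ ^ n) ⁻¹' Metric.cthickening τ Λ := by
    ext x
    rw [hΛ.cthickening_eq_biUnion_closedBall hτ]
    simp [nearSet]
  rw [h1]
  exact isClosed_iInter fun n ↦ Metric.isClosed_cthickening.preimage (continuous_zpow h h' n)

variable [CompactSpace M]

/-- Shadowing of pseudo-orbits by limits of periodic orbits. -/
theorem exists_shadowing {σ : Equiv.Perm M} {Λ : Set M} (hσ : Continuous σ)
    (hcl : HasClosing σ Λ) (hrev : Reversible σ Λ) {τ : ℝ} (hτ : 0 < τ) :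
    ∃ ε > 0, ∀ x : ℤ → M, (∀ n, Step σ Λ ε (x n) (x (n + 1))) →
      ∃ y : ℤ → M, (∀ n, σ (y n) = y (n + 1)) ∧ (∀ n, dist (y n) (x n) ≤ τ) ∧
        y 0 ∈ closure (perSet σ ∩ nearSet σ Λ τ) := by
  obtain ⟨ε₁, h1, hclose⟩ := hcl τ hτ
  obtain ⟨ε₂, h2, hback⟩ := hrev ε₁ h1
  -- The segment from time `-k` to `k + 1` is closed up by a reversed path, and the resulting
  -- periodic pseudo-orbit is shadowed by a periodic orbit. An ultralimit in `k` then shadows all of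
  -- `x`.
  refine ⟨min ε₁ ε₂, lt_min h1 h2, fun x hx ↦ ?_⟩
  have happrox : ∀ k : ℕ, ∃ y : ℤ → M, (∀ n, σ (y n) = y (n + 1)) ∧
      (∀ n : ℤ, -k ≤ n → n ≤ k → dist (y n) (x n) ≤ τ) ∧ y 0 ∈ perSet σ ∩ nearSet σ Λ τ := by
    intro k
    have hk : (x (-k + (2 * k : ℕ) + 1)) = x (k + 1) := by congr 1; push_cast; ring
    have htg := transGen_of_reversible hback (fun n ↦ (hx n).mono (min_le_right _ _)) (-k) (2 * k)
    rw [hk] at htg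
    obtain ⟨n, c, hn, hc0, hcn, hc⟩ := exists_seq_of_transGen htg
    let N := 2 * k + 1 + n
    have hNdef : N = 2 * k + 1 + n := rfl
    have : NeZero N := ⟨by omega⟩
    let X : ℕ → M := fun j ↦ if j ≤ 2 * k + 1 then x (j - k) else c (j - (2 * k + 1))
    have hX0 : X 0 = x (-k) := by simp [X]
    have hXN : X N = x (-k) := by
      have h3 : ¬ N ≤ 2 * k + 1 := by omega
      have h4 : N - (2 * k + 1) = n := by omega
      simp only [X, h3, if_false, h4, hcn]
    have hXstep : ∀ j < N, Step σ Λ ε₁ (X j) (X (j + 1)) := by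
      intro j hj
      rcases Nat.lt_or_ge j (2 * k + 1) with h3 | h3
      · have h4 : j ≤ 2 * k + 1 := h3.le
        have h5 : j + 1 ≤ 2 * k + 1 := h3
        have h6 : ((j + 1 : ℕ) : ℤ) - k = (j - k) + 1 := by push_cast; ring
        simp only [X, h4, h5, if_true, h6]
        exact (hx _).mono (min_le_left _ _)
      · have h5 : ¬ (j + 1 ≤ 2 * k + 1) := by omega
        have h6 : X j = c (j - (2 * k + 1)) := by
          rcases h3.eq_or_lt with h7 | h7
          · subst h7
            simp only [X, le_refl, if_true, Nat.sub_self, hc0]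
            congr 1; push_cast; ring
          · simp only [X, not_le.2 h7, if_false]
        have h8 : j + 1 - (2 * k + 1) = j - (2 * k + 1) + 1 := by omega
        rw [h6]
        simp only [X, h5, if_false, h8]
        exact hc _ (by omega)
    obtain ⟨Y, hY, hYX⟩ := hclose N (fun j ↦ X j.val) (fun j ↦ (hXstep _ (ZMod.val_lt j)).1)
      (fun j ↦ by
        have h3 := (hXstep _ (ZMod.val_lt j)).2.2
        rcases Nat.lt_or_ge (j.val + 1) N with h4 | h4
        · have h5 : (1 : ZMod N).val = 1 := by
            rw [ZMod.val_one_eq_one_mod, Nat.mod_eq_of_lt (by omega)]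
          rwa [ZMod.val_add_of_lt (by rwa [h5]), h5]
        · have h5 : j.val + 1 = N := le_antisymm (ZMod.val_lt j) h4
          have h6 : j + 1 = 0 := by
            have := congrArg (Nat.cast : ℕ → ZMod N) h5
            simpa using this
          rw [h5, hXN, ← hX0] at h3
          rw [h6, ZMod.val_zero]
          exact h3)
    have hy : ∀ n : ℤ, σ (Y ((k + n : ℤ) : ZMod N)) = Y ((k + (n + 1) : ℤ) : ZMod N) := fun n ↦ by
      rw [hY]; congr 1; push_cast; ring
    -- The loop starts at `x (-k)`, so the shift by `k` puts time zero at `x 0`.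
    refine ⟨fun n ↦ Y ((k + n : ℤ) : ZMod N), hy, fun n hn1 hn2 ↦ ?_, ⟨N, NeZero.ne N, ?_⟩, fun n ↦ ?_⟩
    · obtain ⟨m, hm⟩ : ∃ m : ℕ, (k : ℤ) + n = m := ⟨(k + n).toNat, by omega⟩
      have h3 := hYX ((k + n : ℤ) : ZMod N)
      rw [hm, Int.cast_natCast, ZMod.val_cast_of_lt (by omega)] at h3
      have h4 : X m = x n := by
        have h5 : m ≤ 2 * k + 1 := by omega
        have h6 : (m : ℤ) - k = n := by omega
        simp only [X, h5, if_true, h6]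
      rw [h4] at h3
      simp only [hm, Int.cast_natCast]
      exact h3
    · have h3 := eq_zpow_of_orbit (σ := σ) hy N
      rw [zpow_natCast] at h3
      simpa using h3
    · rw [eq_zpow_of_orbit (σ := σ) hy n]
      exact ⟨_, (hXstep _ (ZMod.val_lt _)).1, hYX _⟩
  choose y hy hyx hyp using happrox
  have hU : ((hyperfilter ℕ : Ultrafilter ℕ) : Filter ℕ) ≤ atTop := by
    rw [← Nat.cofinite_eq_atTop]; exact hyperfilter_le_cofinite
  choose Y hYu hY using fun n : ℤ ↦ exists_tendsto_ultrafilter (isCompact_univ (X := M))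
    (hyperfilter ℕ) (f := fun k ↦ y k n) (Eventually.of_forall fun _ ↦ mem_univ _)
  refine ⟨Y, fun n ↦ ?_, fun n ↦ ?_, mem_closure_of_tendsto (hY 0) (Eventually.of_forall hyp)⟩
  · refine tendsto_nhds_unique ((hσ.tendsto _).comp (hY n)) ((hY (n + 1)).congr fun k ↦ ?_)
    exact (hy k n).symm
  · refine le_of_tendsto ((hY n).dist tendsto_const_nhds) (hU ?_)
    filter_upwards [eventually_ge_atTop n.natAbs] with k hk
    exact hyx k n (by omega) (by omega)

end Dynamics

/-! ### Chains and chain recurrent classes -/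

section Chains

variable {M : Type*} [MetricSpace M]

theorem hasChain_iff_transGen {f : M → M} {ε : ℝ} {x y : M} :
    HasChain f ε x y ↔ Relation.TransGen (fun x y ↦ dist (f x) y < ε) x y := by
  constructor
  · rintro ⟨n, c, hn, rfl, rfl, hc⟩
    have h1 : ∀ j, dist (f (c j)) (c (j + 1)) < ε ∨ n ≤ j := fun j ↦ by
      rcases Nat.lt_or_ge j n with h | h
      · exact Or.inl (hc (j + 1) (by omega) h)
      · exact Or.inr h
    have h2 : ∀ m, m + 1 ≤ n →
        Relation.TransGen (fun x y ↦ dist (f x) y < ε) (c 0) (c (m + 1)) := by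
      intro m
      induction m with
      | zero => exact fun h ↦ .single ((h1 0).resolve_right (by omega))
      | succ m ih => exact fun h ↦ (ih (by omega)).tail ((h1 (m + 1)).resolve_right (by omega))
    obtain ⟨m, rfl⟩ : ∃ m, n = m + 1 := ⟨n - 1, by omega⟩
    exact h2 m le_rfl
  · intro h
    obtain ⟨n, c, hn, h0, h1, hc⟩ := exists_seq_of_transGen h
    refine ⟨n, c, hn, h0, h1, fun j hj1 hj2 ↦ ?_⟩
    obtain ⟨m, rfl⟩ : ∃ m, j = m + 1 := ⟨j - 1, by omega⟩
    exact hc m hj2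

theorem HasChain.trans {f : M → M} {ε : ℝ} {x y z : M} (h : HasChain f ε x y)
    (h' : HasChain f ε y z) : HasChain f ε x z :=
  hasChain_iff_transGen.2 ((hasChain_iff_transGen.1 h).trans (hasChain_iff_transGen.1 h'))

/-- The points `z` may depend on `ε`: each is chained to the base point of the class in both
directions at every scale. -/
theorem IsChainRecurrentClass.mem_of_hasChain {f : M → M} {Λ : Set M}
    (hΛ : IsChainRecurrentClass f Λ) {y : M}
    (h : ∀ ε > 0, (∃ z ∈ Λ, HasChain f ε z y) ∧ ∃ z ∈ Λ, HasChain f ε y z) : y ∈ Λ := by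
  obtain ⟨x, -, rfl⟩ := hΛ
  have key : ∀ ε > 0, HasChain f ε x y ∧ HasChain f ε y x := fun ε hε ↦ by
    obtain ⟨⟨z, hz, hzy⟩, z', hz', hyz'⟩ := h ε hε
    exact ⟨(hz.2 ε hε).1.trans hzy, hyz'.trans (hz'.2 ε hε).2⟩
  exact ⟨fun ε hε ↦ (key ε hε).2.trans (key ε hε).1, key⟩

theorem zpow_mem_nearSet {σ : Equiv.Perm M} {Λ : Set M} {τ : ℝ} {x : M} (hx : x ∈ nearSet σ Λ τ)
    (n : ℤ) : (σ ^ n) x ∈ nearSet σ Λ τ := fun m ↦ by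
  rw [← zpow_add_apply]; exact hx _

theorem nearSet_mono {σ : Equiv.Perm M} {Λ : Set M} {τ τ' : ℝ} (h : τ ≤ τ') :
    nearSet σ Λ τ ⊆ nearSet σ Λ τ' := fun _ hx n ↦
  (hx n).imp fun _ hz ↦ ⟨hz.1, hz.2.trans h⟩

/-- A point in the closure of the periodic points whose orbit accumulates on a chain recurrent
class belongs to the class. -/
theorem IsChainRecurrentClass.mem_of_closure_perSet {σ : Equiv.Perm M} {Λ : Set M}
    (hσ : Continuous σ) (hσ' : Continuous σ.symm) (hΛ : IsChainRecurrentClass σ Λ)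
    (hinv : σ '' Λ = Λ) {w : M} (hw : w ∈ closure (perSet σ))
    (hacc : ∀ ε > 0, ∃ m : ℤ, ∃ a ∈ Λ, dist ((σ ^ m) w) a < ε) : w ∈ Λ := by
  refine hΛ.mem_of_hasChain fun ε hε ↦ ?_
  obtain ⟨m, a, ha, hma⟩ := hacc ε hε
  have h1 : ∀ᶠ q in 𝓝 w, dist ((σ ^ m) q) a < ε :=
    (((continuous_zpow hσ hσ' m).tendsto w).dist tendsto_const_nhds).eventually_lt_const hma
  have h2 : ∀ᶠ q in 𝓝 w, dist (σ w) (σ q) < ε := by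
    refine (tendsto_const_nhds.dist (hσ.tendsto w)).eventually_lt_const ?_
    rwa [dist_self]
  have h3 : ∀ᶠ q in 𝓝 w, dist q w < ε := Metric.ball_mem_nhds w hε
  obtain ⟨q, ⟨N, hN0, hN⟩, ⟨hq1, hq2⟩, hq3⟩ :=
    ((mem_closure_iff_frequently.1 hw).and_eventually ((h1.and h2).and h3)).exists
  have hNpos : (1 : ℤ) ≤ N := by exact_mod_cast Nat.one_le_iff_ne_zero.2 hN0
  have hle : ∀ k : ℤ, 0 ≤ k → k ≤ N * k := fun k hk ↦ by nlinarith
  have hper := zpow_mul_apply_of_mem_perSet hN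
  -- The periodic orbit of `q` passes near `a` and returns to `q`, which is near `w`, so following
  -- it gives both chains. Starting at the preimage of `a` makes the first jump land on `(σ ^ m) q`;
  -- the multiples of `N` are large enough for positive length.
  refine ⟨⟨(σ ^ (-1 : ℤ)) a, zpow_mem hinv ha _, ?_⟩, a, ha, ?_⟩
  · refine hasChain_of_orbit hε (zpow_orbit σ q) (a := m) (b := N * (m.natAbs + 1)) ?_ ?_ ?_
    · have := hle (m.natAbs + 1) (by omega)
      omega
    · rw [zpow_orbit, dist_comm]
      exact hq1
    · rw [hper]
      exact hq3
  · refine hasChain_of_orbit hε (zpow_orbit σ q) (a := 1) (b := m + N * (m.natAbs + 2)) ?_ ?_ ?_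
    · have := hle (m.natAbs + 2) (by omega)
      omega
    · rw [zpow_one]
      exact hq2
    · rw [zpow_add_apply, hper]
      exact hq1

/-- Mixing joins any two points of `Λ`, so the size of the step to be reversed is irrelevant and one
serves as a dummy value. -/
theorem reversible_of_mixing {σ : Equiv.Perm M} {Λ : Set M} (hinv : σ '' Λ = Λ)
    (hmix : IsMixingOn σ Λ) : Reversible σ Λ := fun _ hε ↦
  ⟨1, one_pos, fun _ _ h ↦ transGen_of_mixing hinv hmix hε h.2.1 h.1⟩

end Chains

/-! ### Maximality from shadowing, expansivity and commutation -/

section Dynamics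

variable {M : Type*} [MetricSpace M] [CompactSpace M]

theorem hyperfilter_nat_le_atTop : ((hyperfilter ℕ : Ultrafilter ℕ) : Filter ℕ) ≤ atTop := by
  rw [← Nat.cofinite_eq_atTop]; exact hyperfilter_le_cofinite

/-- Limits of shifted orbits. -/
theorem exists_orbit_limit {σ : Equiv.Perm M} (hσ : Continuous σ) (x : ℕ → ℤ → M)
    (hx : ∀ k n, σ (x k n) = x k (n + 1)) :
    ∃ y : ℤ → M, (∀ n, σ (y n) = y (n + 1)) ∧
      ∀ n, Tendsto (fun k ↦ x k n) (hyperfilter ℕ : Ultrafilter ℕ) (𝓝 (y n)) := by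
  choose Y hYu hY using fun n : ℤ ↦ exists_tendsto_ultrafilter (isCompact_univ (X := M))
    (hyperfilter ℕ) (f := fun k ↦ x k n) (Eventually.of_forall fun _ ↦ mem_univ _)
  refine ⟨Y, fun n ↦ ?_, hY⟩
  refine tendsto_nhds_unique ((hσ.tendsto _).comp (hY n)) ((hY (n + 1)).congr fun k ↦ ?_)
  exact (hx k n).symm

/-- An orbit that stays close to an orbit in `Λ` along a half-line is asymptotic to it. -/
theorem ExpansiveNear.exists_dist_lt {σ : Equiv.Perm M} {Λ : Set M} {τ : ℝ}
    (hexp : ExpansiveNear σ Λ τ) (hτ : 0 ≤ τ) (hσ : Continuous σ) (hΛ : IsClosed Λ) {a b : ℤ → M}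
    (ha : ∀ n, σ (a n) = a (n + 1)) (hb : ∀ n, σ (b n) = b (n + 1)) (haΛ : ∀ n, a n ∈ Λ)
    {s : ℕ → ℤ} (h : ∀ m : ℤ, ∀ᶠ j in atTop, dist (a (m + s j)) (b (m + s j)) ≤ τ)
    {ε : ℝ} (hε : 0 < ε) (j₀ : ℕ) : ∃ j ≥ j₀, dist (a (s j)) (b (s j)) < ε := by
  obtain ⟨A, hA, hAt⟩ := exists_orbit_limit hσ (fun j n ↦ a (n + s j)) fun k n ↦ by
    rw [ha]; congr 1; ring
  obtain ⟨B, hB, hBt⟩ := exists_orbit_limit hσ (fun j n ↦ b (n + s j)) fun k n ↦ by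
    rw [hb]; congr 1; ring
  -- After shifting by `s j`, the limit orbits are `τ`-close at all times, so they coincide.
  have hAB := hexp A B hA hB
    (fun n ↦ ⟨A n, hΛ.mem_of_tendsto (hAt n) (Eventually.of_forall fun _ ↦ haΛ _), by
      rwa [dist_self]⟩)
    (fun n ↦ le_of_tendsto ((hAt n).dist (hBt n)) (hyperfilter_nat_le_atTop (h n))) 0
  have h0 := (hAt 0).dist (hBt 0)
  rw [hAB, dist_self] at h0
  obtain ⟨j, hj1, hj2⟩ := ((h0.eventually_lt_const hε).and
    (hyperfilter_nat_le_atTop (eventually_ge_atTop j₀))).exists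
  refine ⟨j, hj2, ?_⟩
  simpa using hj1

/-- Orbits close to a chain recurrent class with closing and expansivity lie in the class. -/
theorem exists_nearSet_subset_of_class {σ : Equiv.Perm M} {Λ : Set M} (hσ : Continuous σ)
    (hΛ : IsClosed Λ) (hinv : σ '' Λ = Λ) (hclass : IsChainRecurrentClass σ Λ)
    (hcl : HasClosing σ Λ) (hrev : Reversible σ Λ) (hexp : ∃ τ > 0, ExpansiveNear σ Λ τ) :
    ∃ τ > 0, nearSet σ Λ τ ⊆ Λ := by
  obtain ⟨τ₀, hτ₀, hexp⟩ := hexp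
  obtain ⟨ε, hε, hsh⟩ := exists_shadowing hσ hcl hrev (half_pos hτ₀)
  obtain ⟨τ, ⟨hps, hτle⟩, hτ⟩ := (((eventually_pseudoOrbit hσ hε).and
    (nhdsWithin_le_nhds (Iic_mem_nhds (half_pos hτ₀)))).and self_mem_nhdsWithin).exists
  refine ⟨τ, hτ, fun y hy ↦ ?_⟩
  choose x hxΛ hyx using hy
  have hx : ∀ n, Step σ Λ ε (x n) (x (n + 1)) := fun n ↦
    ⟨hxΛ n, hxΛ _, hps _ _ _ _ (hyx n) (hyx (n + 1)) (zpow_orbit σ y n)⟩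
  -- `ξ k` follows `x` on `[-k, k]` and true orbits in `Λ` outside. An orbit shadowing it is
  -- asymptotic to `Λ` at both ends, so chains put it in the class. Letting `k` grow, expansivity
  -- identifies the limit with the orbit of `y`.
  let c : ℕ → ℤ → ℤ := fun k n ↦ max (-(k : ℤ)) (min k n)
  let ξ : ℕ → ℤ → M := fun k n ↦ (σ ^ (n - c k n)) (x (c k n))
  have hξ : ∀ k n, Step σ Λ ε (ξ k n) (ξ k (n + 1)) := by
    intro k n
    refine ⟨zpow_mem hinv (hxΛ _) _, zpow_mem hinv (hxΛ _) _, ?_⟩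
    rcases eq_or_ne (c k n) (c k (n + 1)) with h | h
    · have h1 : σ (ξ k n) = ξ k (n + 1) := by
        simp only [ξ]
        rw [zpow_orbit, ← h]
        congr 2
        ring
      rw [h1, dist_self]
      exact hε
    · have h1 : c k n = n := by simp only [c] at h ⊢; omega
      have h2 : c k (n + 1) = n + 1 := by simp only [c] at h ⊢; omega
      simp only [ξ, h1, h2, sub_self, zpow_zero, Equiv.Perm.coe_one, id_eq]
      exact (hx n).2.2
  choose Y hY hYξ hYcl using fun k ↦ hsh (ξ k) (hξ k)
  have hτ₀2 : τ₀ / 2 ≤ τ₀ := by linarith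
  have hYΛ : ∀ k, Y k 0 ∈ Λ := by
    intro k
    refine hclass.mem_of_hasChain fun η hη ↦ ⟨?_, ?_⟩
    · obtain ⟨j, hj, hjd⟩ := hexp.exists_dist_lt hτ₀.le hσ hΛ
        (a := fun n ↦ (σ ^ (n + k)) (x (-k))) (b := Y k)
        (fun n ↦ by rw [zpow_orbit]; congr 2; ring)
        (hY k) (fun n ↦ zpow_mem hinv (hxΛ _) _) (s := fun j ↦ -(j : ℤ)) (fun m ↦ by
          filter_upwards [eventually_ge_atTop (m.natAbs + k)] with j hj
          have h1 := hYξ k (m + -(j : ℤ))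
          have h2 : c k (m + -(j : ℤ)) = -k := by simp only [c]; omega
          simp only [ξ, h2, sub_neg_eq_add] at h1
          rw [dist_comm]
          exact h1.trans hτ₀2) hη 1
      refine ⟨(σ ^ (-1 : ℤ)) ((σ ^ (-(j : ℤ) + k)) (x (-k))),
        zpow_mem hinv (zpow_mem hinv (hxΛ _) _) _, ?_⟩
      refine hasChain_of_orbit hη (hY k) (a := -(j : ℤ)) (b := 0) (by omega) ?_ ?_
      · rw [zpow_orbit]
        exact hjd
      · rwa [dist_self]
    · obtain ⟨j, hj, hjd⟩ := hexp.exists_dist_lt hτ₀.le hσ hΛ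
        (a := fun n ↦ (σ ^ (n - k)) (x k)) (b := Y k)
        (fun n ↦ by rw [zpow_orbit]; congr 2; ring)
        (hY k) (fun n ↦ zpow_mem hinv (hxΛ _) _) (s := fun j ↦ (j : ℤ)) (fun m ↦ by
          filter_upwards [eventually_ge_atTop (m.natAbs + k)] with j hj
          have h1 := hYξ k (m + (j : ℤ))
          have h2 : c k (m + (j : ℤ)) = k := by simp only [c]; omega
          simp only [ξ, h2] at h1
          rw [dist_comm]
          exact h1.trans hτ₀2) hη 2
      refine ⟨(σ ^ ((j : ℤ) - k)) (x k), zpow_mem hinv (hxΛ _) _, ?_⟩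
      refine hasChain_of_orbit hη (hY k) (a := 1) (b := j) (by omega) ?_ ?_
      · rw [hY, zero_add]
        rwa [dist_self]
      · rw [dist_comm]
        exact hjd
  obtain ⟨Z, hZ, hZt⟩ := exists_orbit_limit hσ Y hY
  have hZx : ∀ n, dist (Z n) (x n) ≤ τ₀ / 2 := fun n ↦ by
    refine le_of_tendsto ((hZt n).dist tendsto_const_nhds) (hyperfilter_nat_le_atTop ?_)
    filter_upwards [eventually_ge_atTop n.natAbs] with k hk
    have h1 := hYξ k n
    have h2 : c k n = n := by simp only [c]; omega
    simpa only [ξ, h2, sub_self, zpow_zero, Equiv.Perm.coe_one, id_eq] using h1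
  have hyZ := hexp (fun n ↦ (σ ^ n) y) Z (zpow_orbit σ y) hZ
    (fun n ↦ ⟨x n, hxΛ n, (hyx n).trans (hτle.trans hτ₀2)⟩) (fun n ↦ by
      have h1 := dist_triangle_right ((σ ^ n) y) (Z n) (x n)
      have h2 : τ ≤ τ₀ / 2 := hτle
      linarith [hyx n, hZx n]) 0
  have h0 : y = Z 0 := hyZ
  rw [h0]
  exact hΛ.mem_of_tendsto (hZt 0) (Eventually.of_forall hYΛ)

/-- Orbits close to `Λ` are limits of periodic orbits close to `Λ`. -/
theorem exists_nearSet_subset_closure {σ : Equiv.Perm M} {Λ : Set M} (hσ : Continuous σ)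
    (hcl : HasClosing σ Λ) (hrev : Reversible σ Λ) (hexp : ∃ τ > 0, ExpansiveNear σ Λ τ)
    {τ₁ : ℝ} (hτ₁ : 0 < τ₁) :
    ∃ τ > 0, nearSet σ Λ τ ⊆ closure (perSet σ ∩ nearSet σ Λ τ₁) := by
  obtain ⟨τ₀, hτ₀, hexp⟩ := hexp
  obtain ⟨ε, hε, hsh⟩ := exists_shadowing hσ hcl hrev (lt_min (half_pos hτ₀) hτ₁)
  obtain ⟨τ, ⟨hps, hτle⟩, hτ⟩ := (((eventually_pseudoOrbit hσ hε).and
    (nhdsWithin_le_nhds (Iic_mem_nhds (half_pos hτ₀)))).and self_mem_nhdsWithin).exists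
  have hτle : τ ≤ τ₀ / 2 := hτle
  refine ⟨τ, hτ, fun y hy ↦ ?_⟩
  choose x hxΛ hyx using hy
  obtain ⟨Z, hZ, hZx, hZcl⟩ := hsh x fun n ↦
    ⟨hxΛ n, hxΛ _, hps _ _ _ _ (hyx n) (hyx (n + 1)) (zpow_orbit σ y n)⟩
  have h0 : y = Z 0 := hexp (fun n ↦ (σ ^ n) y) Z (zpow_orbit σ y) hZ
    (fun n ↦ ⟨x n, hxΛ n, by linarith [hyx n]⟩) (fun n ↦ by
      have h1 := dist_triangle_right ((σ ^ n) y) (Z n) (x n)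
      have h2 := (hZx n).trans (min_le_left _ _)
      linarith [hyx n]) 0
  rw [h0]
  exact closure_mono (inter_subset_inter_right _ (nearSet_mono (min_le_right _ _))) hZcl

/-- Pseudo-orbits in `Λ` can be reversed if the periodic points are dense in `Λ`. -/
theorem reversible_of_dense_periodic {σ : Equiv.Perm M} {Λ : Set M} (hσ : Continuous σ)
    (hinv : σ '' Λ = Λ) (hper : Λ ⊆ closure (perSet σ ∩ Λ)) : Reversible σ Λ := by
  intro ε hε
  obtain ⟨ε', hmap, hε'⟩ := ((eventually_dist_map_le hσ hε).and self_mem_nhdsWithin).exists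
  have hε' : 0 < ε' := hε'
  refine ⟨ε' / 2, half_pos hε', fun x y hxy ↦ ?_⟩
  have h1 : ∀ᶠ p in 𝓝 x, dist (σ x) (σ p) < ε' / 2 := by
    refine (tendsto_const_nhds.dist (hσ.tendsto x)).eventually_lt_const ?_
    rw [dist_self]; exact half_pos hε'
  have h2 : ∀ᶠ p in 𝓝 x, dist p x < ε := Metric.ball_mem_nhds x hε
  obtain ⟨p, ⟨⟨N, hN0, hN⟩, hpΛ⟩, hp1, hp2⟩ :=
    ((mem_closure_iff_frequently.1 (hper hxy.1)).and_eventually (h1.and h2)).exists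
  -- Since `y` is near `σ p`, the path enters the orbit of `p` at time two and follows it back to
  -- `p`, near `x`. The return time `3 * N` exceeds two even when `N = 1`.
  have hs1 : Step σ Λ ε y ((σ ^ ((2 : ℕ) : ℤ)) p) := by
    refine ⟨hxy.2.1, zpow_mem hinv hpΛ _, ?_⟩
    have h3 : (σ ^ ((2 : ℕ) : ℤ)) p = σ (σ p) := by
      rw [zpow_natCast, pow_two]; rfl
    rw [h3]
    refine hmap _ _ ?_
    have := dist_triangle_left y (σ p) (σ x)
    linarith [hxy.2.2]
  have hs2 := reflTransGen_orbit hinv hε hpΛ 2 (3 * N - 3)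
  have hs3 : Step σ Λ ε ((σ ^ ((2 + (3 * N - 3) : ℕ) : ℤ)) p) x := by
    refine ⟨zpow_mem hinv hpΛ _, hxy.1, ?_⟩
    have h3 : ((2 + (3 * N - 3) : ℕ) : ℤ) + 1 = N * 3 := by
      have : 3 ≤ 3 * N := by omega
      omega
    rw [zpow_orbit, h3, zpow_mul_apply_of_mem_perSet hN]
    exact hp2
  exact (Relation.TransGen.head' hs1 hs2).tail hs3

/-- A true orbit in `Λ` is shadowed by a limit of periodic orbits staying near `Λ`, and by
maximality these lie in `Λ`. -/
theorem subset_closure_perSet {σ : Equiv.Perm M} {Λ : Set M} (hσ : Continuous σ)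
    (hinv : σ '' Λ = Λ) (hcl : HasClosing σ Λ) (hrev : Reversible σ Λ)
    (hmax : ∃ τ > 0, nearSet σ Λ τ ⊆ Λ) : Λ ⊆ closure (perSet σ ∩ Λ) := by
  obtain ⟨τ, hτ, hmax⟩ := hmax
  intro x hx
  refine Metric.mem_closure_iff.2 fun η hη ↦ ?_
  obtain ⟨ε, hε, hsh⟩ := exists_shadowing hσ hcl hrev (lt_min hτ (half_pos hη))
  obtain ⟨y, -, hyx, hycl⟩ := hsh (fun n ↦ (σ ^ n) x) fun n ↦
    ⟨zpow_mem hinv hx _, zpow_mem hinv hx _, by rw [zpow_orbit, dist_self]; exact hε⟩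
  obtain ⟨p, ⟨hp1, hp2⟩, hyp⟩ := Metric.mem_closure_iff.1 hycl _ (half_pos hη)
  refine ⟨p, ⟨hp1, hmax (nearSet_mono (min_le_left _ _) hp2)⟩, ?_⟩
  have h1 : dist (y 0) x ≤ η / 2 := (hyx 0).trans (min_le_right _ _)
  have h2 := dist_triangle_left x p (y 0)
  linarith

variable {σ γ : Equiv.Perm M} {Λ : Set M}

/-- Shifts of the `σ`-orbit of `w` along `s` converge to a full orbit inside the closed set `nearSet
γ Λ τ`, hence `τ`-close to `Λ`, hence in `Λ`. So the orbit of `w` accumulates on `Λ`, and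
approximation by periodic points does the rest. The cases `s j = j` and `s j = -j` handle forward
and backward half-orbits. -/
theorem mem_of_tail_nearSet (hσ : Continuous σ) (hσ' : Continuous σ.symm)
    (hγ : Continuous γ) (hγ' : Continuous γ.symm) (hΛ : IsCompact Λ)
    (hinv : σ '' Λ = Λ) (hclass : IsChainRecurrentClass σ Λ) {τ : ℝ} (hτ : 0 ≤ τ)
    (hmax : nearSet σ Λ τ ⊆ Λ) (hper : nearSet γ Λ τ ⊆ closure (perSet σ)) {w : M}
    (hw : w ∈ nearSet γ Λ τ) {s : ℕ → ℤ}
    (hs : ∀ m : ℤ, ∀ᶠ j in atTop, (σ ^ (m + s j)) w ∈ nearSet γ Λ τ) : w ∈ Λ := by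
  obtain ⟨A, hA, hAt⟩ := exists_orbit_limit hσ (fun j n ↦ (σ ^ (n + s j)) w) fun k n ↦ by
    rw [zpow_orbit]; congr 2; ring
  have hA0 : A 0 ∈ Λ := hmax fun n ↦ by
    rw [eq_zpow_of_orbit hA]
    exact (isClosed_nearSet hγ hγ' hΛ hτ).mem_of_tendsto (hAt n)
      (hyperfilter_nat_le_atTop (hs n)) 0
  refine hclass.mem_of_closure_perSet hσ hσ' hinv (hper hw) fun ε hε ↦ ?_
  obtain ⟨j, hj⟩ := ((hAt 0).eventually (Metric.ball_mem_nhds _ hε)).exists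
  exact ⟨_, A 0, hA0, hj⟩

/-- If orbits of `γ` close to `Λ` are limits of `σ`-periodic points, then `Λ` is the maximal
`γ`-invariant subset of a neighbourhood. -/
theorem exists_nearSet_subset_of_commute (hσ : Continuous σ) (hσ' : Continuous σ.symm)
    (hγ : Continuous γ) (hγ' : Continuous γ.symm) (hcomm : Commute σ γ) (hΛ : IsCompact Λ)
    (hinv : σ '' Λ = Λ) (hclass : IsChainRecurrentClass σ Λ) (hmax : ∃ τ > 0, nearSet σ Λ τ ⊆ Λ)
    (hper : ∃ τ > 0, nearSet γ Λ τ ⊆ closure (perSet σ)) : ∃ τ > 0, nearSet γ Λ τ ⊆ Λ := by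
  obtain ⟨τ, hτ, hmax, hper⟩ : ∃ τ > 0, nearSet σ Λ τ ⊆ Λ ∧ nearSet γ Λ τ ⊆ closure (perSet σ) := by
    obtain ⟨τ₁, h1, h1'⟩ := hmax
    obtain ⟨τ₂, h2, h2'⟩ := hper
    exact ⟨min τ₁ τ₂, lt_min h1 h2, (nearSet_mono (min_le_left _ _)).trans h1',
      (nearSet_mono (min_le_right _ _)).trans h2'⟩
  have hcz : ∀ m n : ℤ, ∀ x, (σ ^ m) ((γ ^ n) x) = (γ ^ n) ((σ ^ m) x) := fun m n x ↦
    congrArg (fun e : Equiv.Perm M ↦ e x) ((hcomm.zpow_zpow m n).eq)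
  have hpush : ∀ k : ℕ, ∃ δ > 0, ∀ x ∈ nearSet γ Λ δ, (σ ^ (k : ℤ)) x ∈ nearSet γ Λ τ := by
    intro k
    obtain ⟨δ, hmap, hδ⟩ := ((eventually_dist_map_le (continuous_zpow hσ hσ' k) hτ).and
      self_mem_nhdsWithin).exists
    refine ⟨δ, hδ, fun x hx n ↦ ?_⟩
    obtain ⟨z, hz, hxz⟩ := hx n
    refine ⟨_, zpow_mem hinv hz k, ?_⟩
    rw [← hcz]
    exact (hmap _ _ hxz).le
  by_contra! hcon
  have hex : ∀ j : ℕ, ∃ z ∈ nearSet γ Λ (min τ (1 / ((j : ℝ) + 1))), z ∉ Λ := fun j ↦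
    not_subset.1 (hcon _ (lt_min hτ (by positivity)))
  choose z hz hzΛ using hex
  have hexit : ∀ j, ∃ n : ℕ, (σ ^ (n : ℤ)) (z j) ∉ nearSet γ Λ τ := by
    intro j
    by_contra! hall
    refine hzΛ j (mem_of_tail_nearSet hσ hσ' hγ hγ' hΛ hinv hclass hτ.le hmax hper
      (hall 0) (s := fun j ↦ (j : ℤ)) fun m ↦ ?_)
    filter_upwards [eventually_ge_atTop m.natAbs] with i hi
    have h1 : m + (i : ℤ) = (m + i).toNat := by omega
    rw [h1]
    exact hall _
  have hmin : ∀ j, ∃ n : ℕ, (σ ^ (n : ℤ)) (z j) ∉ nearSet γ Λ τ ∧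
      ∀ k < n, (σ ^ (k : ℤ)) (z j) ∈ nearSet γ Λ τ := fun j ↦ by
    classical
    exact ⟨Nat.find (hexit j), Nat.find_spec (hexit j), fun k hk ↦
      not_not.1 (Nat.find_min (hexit j) hk)⟩
  choose n hn hnmin using hmin
  -- By continuity of `σ ^ k`, points whose `γ`-orbit is close enough to `Λ` cannot exit at time
  -- `k`, so exit times tend to infinity.
  have hn_ne : ∀ k, ∀ᶠ j in atTop, n j ≠ k := by
    intro k
    obtain ⟨δ, hδ, hk⟩ := hpush k
    filter_upwards [tendsto_one_div_add_atTop_nhds_zero_nat.eventually_lt_const hδ] with j hj hjk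
    refine hn j ?_
    rw [hjk]
    exact hk _ (nearSet_mono ((min_le_right _ _).trans hj.le) (hz j))
  have hn_gt : ∀ m, ∀ᶠ j in atTop, m < n j := by
    intro m
    filter_upwards [(Finset.range (m + 1)).eventually_all.2 fun k _ ↦ hn_ne k] with j hj
    by_contra h
    exact hj (n j) (Finset.mem_range.2 (by omega)) rfl
  have hfar : ∀ j, ∃ l : ℤ, ∀ y ∈ Λ, τ < dist ((γ ^ l) ((σ ^ (n j : ℤ)) (z j))) y := fun j ↦ by
    have := hn j
    simp only [nearSet, mem_ofPred_eq, not_forall, not_exists, not_and, not_le] at this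
    exact this
  choose l hl using hfar
  -- Applying `γ ^ l j` moves the exit point to distance more than `τ` from `Λ`, so the limit at
  -- time zero is off `Λ`. Earlier times remain in the `γ`-invariant set `nearSet γ Λ τ`.
  obtain ⟨W, hW, hWt⟩ := exists_orbit_limit hσ
    (fun j m ↦ (σ ^ m) ((γ ^ (l j)) ((σ ^ (n j : ℤ)) (z j)))) fun k m ↦ zpow_orbit _ _ _
  have hW0 : W 0 ∉ Λ := fun h0 ↦ by
    have h1 : τ ≤ dist (W 0) (W 0) := ge_of_tendsto ((hWt 0).dist tendsto_const_nhds)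
      (Eventually.of_forall fun j ↦ (hl j _ h0).le)
    rw [dist_self] at h1
    exact h1.not_gt hτ
  have hWK : ∀ m : ℤ, m < 0 → W m ∈ nearSet γ Λ τ := by
    intro m hm
    refine (isClosed_nearSet hγ hγ' hΛ hτ.le).mem_of_tendsto (hWt m) (hyperfilter_nat_le_atTop ?_)
    filter_upwards [hn_gt m.natAbs] with j hj
    rw [hcz, ← zpow_add_apply]
    refine zpow_mem_nearSet ?_ _
    have h1 : m + (n j : ℤ) = (m + n j).toNat := by omega
    rw [h1]
    exact hnmin j _ (by omega)
  refine hW0 ?_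
  have hWm : W (-1) ∈ Λ := by
    refine mem_of_tail_nearSet hσ hσ' hγ hγ' hΛ hinv hclass hτ.le hmax hper
      (hWK (-1) (by omega)) (s := fun j ↦ -(j : ℤ)) fun m ↦ ?_
    filter_upwards [eventually_ge_atTop m.natAbs] with i hi
    rw [← eq_zpow_of_orbit hW (-1), ← zpow_add_apply, eq_zpow_of_orbit hW]
    exact hWK _ (by omega)
  have h1 := hW (-1)
  rw [neg_add_cancel] at h1
  rw [← h1, ← hinv]
  exact mem_image_of_mem _ hWm

end Dynamics

/-! ### From orbits near the set to local maximality -/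

section LocallyMaximal

variable {E : Type*} [NormedAddCommGroup E] [NormedSpace ℝ E]
  {M : Type*} [MetricSpace M] [ChartedSpace E M]
  [RiemannianBundle (fun x : M ↦ TangentSpace 𝓘(ℝ, E) x)]
  {r : WithTop ℕ∞} {h : M ≃ₘ^r⟮𝓘(ℝ, E), 𝓘(ℝ, E)⟯ M} {Λ : Set M}

theorem IsHyperbolicSet.isLocallyMaximal_of_nearSet_subset (hyp : IsHyperbolicSet h Λ)
    (hmax : ∃ τ > 0, nearSet h.toEquiv Λ τ ⊆ Λ) : IsLocallyMaximalHyperbolicSet h Λ := by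
  obtain ⟨τ, hτ, hmax⟩ := hmax
  have hinv : (h.toEquiv : Equiv.Perm M) '' Λ = Λ := hyp.2.1
  refine ⟨hyp, Metric.thickening τ Λ, Metric.isOpen_thickening.mem_nhdsSet.2
    (Metric.self_subset_thickening hτ Λ), Subset.antisymm (fun x hx ↦ mem_iInter.2 fun n ↦ ?_)
    fun x hx ↦ hmax fun n ↦ ?_⟩
  · refine ⟨_, Metric.self_subset_thickening hτ Λ (zpow_mem hinv hx (-n)), ?_⟩
    rw [← zpow_add_apply, add_neg_cancel]
    rfl
  · obtain ⟨u, hu, rfl⟩ := mem_iInter.1 hx (-n)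
    obtain ⟨z, hz, huz⟩ := Metric.mem_thickening_iff.1 hu
    refine ⟨z, hz, ?_⟩
    rw [← zpow_add_apply, add_neg_cancel]
    exact huz.le

end LocallyMaximal

/-! ### Dynamical properties of hyperbolic sets -/

section Hyperbolic

variable {E : Type*} [NormedAddCommGroup E] [NormedSpace ℝ E] [FiniteDimensional ℝ E]
  {M : Type*} [MetricSpace M] [CompactSpace M] [ChartedSpace E M] [IsManifold 𝓘(ℝ, E) ∞ M]
  [RiemannianBundle (fun x : M ↦ TangentSpace 𝓘(ℝ, E) x)]
  {r : WithTop ℕ∞} {h k : M ≃ₘ^r⟮𝓘(ℝ, E), 𝓘(ℝ, E)⟯ M} {Λ : Set M}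

theorem IsHyperbolicSet.exists_expansiveNear (c : ChartCover E M) (hr : 1 ≤ r)
    (hyp : IsHyperbolicSet h Λ) : ∃ τ > 0, ExpansiveNear h.toEquiv Λ τ := by
  obtain ⟨τ, hτ, h0⟩ := ((eventually_expansive c hr hyp).and self_mem_nhdsWithin).exists
  exact ⟨τ, h0, hτ⟩

theorem IsHyperbolicSet.hasClosing (c : ChartCover E M) (hr : 1 ≤ r)
    (hyp : IsHyperbolicSet h Λ) : HasClosing h.toEquiv Λ := fun _ hτ ↦
  exists_closing c hr hyp hτ

/-- Periodic orbits near a hyperbolic set are periodic for commuting diffeomorphisms. -/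
theorem IsHyperbolicSet.exists_perSet_inter_nearSet_subset (c : ChartCover E M) (hr : 1 ≤ r)
    (hyp : IsHyperbolicSet h Λ) (hhk : ∀ x, h (k x) = k (h x)) :
    ∃ τ > 0, perSet h.toEquiv ∩ nearSet h.toEquiv Λ τ ⊆ perSet k.toEquiv := by
  obtain ⟨τ, hτ, h0⟩ := ((eventually_nondegenerate c hr hyp).and self_mem_nhdsWithin).exists
  refine ⟨τ, h0, fun q ⟨⟨N, hN, hq⟩, hnear⟩ ↦ ?_⟩
  have hcomm : Commute (h.toEquiv : Equiv.Perm M) k.toEquiv := Equiv.ext hhk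
  obtain ⟨m, hm, hmq⟩ := exists_iterate_eq_of_commute
    (k := ⇑((h.toEquiv : Equiv.Perm M) ^ N)) (f := k) (f' := k.symm)
    (contMDiff_zpow hr h N) (k.contMDiff.of_le hr) (k.symm.contMDiff.of_le hr)
    k.symm_apply_apply
    (fun x ↦ congrArg (fun e : Equiv.Perm M ↦ e x) (hcomm.pow_left N).eq) hq (hτ q N hN hq hnear)
  refine ⟨m, hm, ?_⟩
  rw [← Equiv.Perm.iterate_eq_pow]
  exact hmq

end Hyperbolic

end CommutingHyperbolic

/-! ### The main theorem -/

theorem mainTheorem4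
    {E : Type*} [NormedAddCommGroup E] [NormedSpace ℝ E] [FiniteDimensional ℝ E]
    {M : Type*} [MetricSpace M] [CompactSpace M] [ConnectedSpace M]
    [ChartedSpace E M] [IsManifold 𝓘(ℝ, E) ∞ M]
    [RiemannianBundle (fun x : M ↦ TangentSpace 𝓘(ℝ, E) x)]
    [IsContinuousRiemannianBundle E (fun x : M ↦ TangentSpace 𝓘(ℝ, E) x)]
    (r : ℕ∞) (hr : 1 ≤ r)
    (f g : M ≃ₘ^(r : WithTop ℕ∞)⟮𝓘(ℝ, E), 𝓘(ℝ, E)⟯ M)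
    (hg : g ∈ CommutingHyperbolic.centralizer f)
    (Λ : Set M)
    (hclass : CommutingHyperbolic.IsChainRecurrentClass f Λ)
    (hmix : CommutingHyperbolic.IsMixingOn f Λ)
    (hf_hyp : CommutingHyperbolic.IsHyperbolicSet f Λ)
    (hg_hyp : CommutingHyperbolic.IsHyperbolicSet g Λ) :
    CommutingHyperbolic.IsLocallyMaximalHyperbolicSet g Λ := by
  open CommutingHyperbolic in
  obtain ⟨c⟩ := exists_chartCover (E := E) (M := M)
  have hr' : (1 : WithTop ℕ∞) ≤ r := by exact_mod_cast hr
  have hfc : Continuous f.toEquiv := f.continuous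
  have hfc' : Continuous f.toEquiv.symm := f.symm.continuous
  have hgc : Continuous g.toEquiv := g.continuous
  have hgc' : Continuous g.toEquiv.symm := g.symm.continuous
  have hf_inv : f.toEquiv '' Λ = Λ := hf_hyp.2.1
  have hg_inv : g.toEquiv '' Λ = Λ := hg_hyp.2.1
  have hf_rev := reversible_of_mixing (σ := f.toEquiv) hf_inv hmix
  have hf_cl := hf_hyp.hasClosing c hr'
  have hf_max := exists_nearSet_subset_of_class hfc hf_hyp.1.isClosed hf_inv hclass hf_cl hf_rev
    (hf_hyp.exists_expansiveNear c hr')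
  have hdense := subset_closure_perSet hfc hf_inv hf_cl hf_rev hf_max
  obtain ⟨τ₁, hτ₁, hfg⟩ := hf_hyp.exists_perSet_inter_nearSet_subset (k := g) c hr' hg
  obtain ⟨τ₂, hτ₂, hgf⟩ := hg_hyp.exists_perSet_inter_nearSet_subset (k := f) c hr'
    fun x ↦ (hg x).symm
  -- Mixing of `g` is not available; the dense `f`-periodic points of `Λ`, being `g`-periodic,
  -- replace it.
  have hg_rev : Reversible g.toEquiv Λ := reversible_of_dense_periodic hgc hg_inv
    (hdense.trans (closure_mono fun p hp ↦ ⟨hfg ⟨hp.1, fun n ↦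
      ⟨_, zpow_mem hf_inv hp.2 n, by rw [dist_self]; exact hτ₁.le⟩⟩, hp.2⟩))
  obtain ⟨τ, hτ, hg_near⟩ := exists_nearSet_subset_closure hgc (hg_hyp.hasClosing c hr') hg_rev
    (hg_hyp.exists_expansiveNear c hr') hτ₂
  -- The transfer is now used in the other direction: `g`-periodic points near `Λ` are `f`-periodic,
  -- because they are nondegenerate for `g`.
  exact hg_hyp.isLocallyMaximal_of_nearSet_subset
    (exists_nearSet_subset_of_commute (σ := f.toEquiv) hfc hfc' hgc hgc' (Equiv.ext hg) hf_hyp.1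
      hf_inv hclass hf_max ⟨τ, hτ, hg_near.trans (closure_mono hgf)⟩)
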